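/- **Notation.** An Orlicz function is a convex function $M:[0,\infty)\to[0,\infty)$ with $M(0)=0$, $M(t)>0$ for $t>0$, $\lim_{t\to0}M(t)/t=0$ and $\lim_{t\to\infty}M(t)/t=\infty$; its conjugate is $M^*(x)=\sup_{t\ge0}(xt-M(t))$, and $(M^*)^{-1}$ is the inverse function of $M^*$ on $[0,\infty)$. For $x\in\mathbb R^n$ let $x_1^*\ge\dots\ge x_n^*$ be the non-increasing rearrangement of $|x_1|,\dots,|x_n|$, and for $a_1\ge\dots\ge a_n>0$ let $$\|x\|_{M,a}=\inf\Big\{\rho>0:\sum_{i=1}^nM\Big(\frac{a_ix_i^*}{\rho}\Big)\le1\Big\}.$$ Let $1<p<2$ and $A,B\in(0,\infty)$. For $d_1\ge\dots\ge d_n>0$, an Orlicz function $M_d$ is said to be related to $d$ (with constants $A,B$) if for all $\ell=1,\dots,n$ $$A\,\Phi_d(\ell)\le(M_d^*)^{-1}\Big(\frac{\ell}{n}\Big)\le B\,\Phi_d(\ell),\qquad \Phi_d(\ell)=\frac1n\sum_{i=1}^{\ell}|d_i|+\Big(\frac{\ell}{n}\Big)^{1-1/p}\Big(\frac1n\sum_{i=\ell+1}^n|d_i|^p\Big)^{1/p}.$$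 **Theorem.** Let $1<p<2$ and $A,B,C_1,C_2\in(0,\infty)$. There are constants $c_1,c_2\in(0,\infty)$, where $c_1$ depends only on $p,A,B$ and $c_2$ depends only on $p,A,B,C_1,C_2$, with the following property. Let $n\in\mathbb N$, $d_1\ge\dots\ge d_n>0$, $a_1\ge\dots\ge a_n>0$, and let $M_d$ be an Orlicz function related to $d$ with constants $A,B$. Let $z=\big((n/i)^{1/p}\big)_{i=1}^n$, and for $k=1,\dots,n$ let $c^k=(a_k,\dots,a_k,0,\dots,0)\in\mathbb R^n$ have exactly $\lfloor n/k\rfloor$ non-zero entries. Assume that for all $x\in\mathbb R^n$ $$\bigg\|\bigg(\Big(\frac1k\sum_{i=1}^k|x_i^*|^p\Big)^{1/p}\bigg)_{k=1}^n\bigg\|_{M_d,a}\le C_1\|x\|_{M_d,a}\quad\text{and}\quad\bigg\|\bigg(\Big(\frac1k\sum_{i=k+1}^n|x_i^*|^2\Big)^{1/2}\bigg)_{k=1}^n\bigg\|_{M_d,a}\le C_2\|x\|_{M_d,a}.$$ Then for all $x\in\mathbb R^n$ $$c_1\|x\|_{M_d,a}\le\frac1{(n!)^3}\sum_{\pi,\sigma,\eta\in\mathfrak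 S_n}\Big(\sum_{i,k=1}^n\big|x_i\,c^k_{\pi(i)}\,d_{\sigma(k)}\,z_{\eta(k)}\big|^2\Big)^{1/2}\le c_2\|x\|_{M_d,a}.$$ -/

import Mathlib

open Filter Topology

noncomputable section

/-- An Orlicz function (more precisely an N-function). Only the values of `M` on `[0, ∞)` matter. -/
structure IsOrliczFunction (M : ℝ → ℝ) : Prop where
  convexOn : ConvexOn ℝ (Set.Ici 0) M
  map_zero : M 0 = 0
  pos : ∀ t, 0 < t → 0 < M t
  tendsto_zero : Tendsto (fun t => M t / t) (𝓝[>] 0) (𝓝 0)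
  tendsto_atTop : Tendsto (fun t => M t / t) atTop atTop

/-- The conjugate function `M^*(x) = sup_{t ≥ 0} (x t - M t)`. -/
def orliczConj (M : ℝ → ℝ) (x : ℝ) : ℝ :=
  sSup ((fun t => x * t - M t) '' Set.Ici 0)

/-- The inverse of an increasing bijection `F` of `[0, ∞)`. -/
def orliczInv (F : ℝ → ℝ) : ℝ → ℝ :=
  Function.invFunOn F (Set.Ici 0)

/-- The non-increasing rearrangement `x^*` of `|x_1|, …, |x_n|`. -/
def decRearr {n : ℕ} (x : Fin n → ℝ) (i : Fin n) : ℝ :=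
  |x (Tuple.sort (fun j => -|x j|) i)|

/-- The Orlicz-Lorentz norm
`‖x‖_{M,a} = inf {ρ > 0 : ∑ i, M (a_i x^*_i / ρ) ≤ 1}`. -/
def orliczLorentzNorm {n : ℕ} (M : ℝ → ℝ) (a x : Fin n → ℝ) : ℝ :=
  sInf {ρ : ℝ | 0 < ρ ∧ ∑ i, M (a i * decRearr x i / ρ) ≤ 1}

/-- For `1 ≤ ℓ ≤ n`, the quantity
`(1/n) ∑_{i ≤ ℓ} |d_i| + (ℓ/n)^{1 - 1/p} ((1/n) ∑_{i > ℓ} |d_i|^p)^{1/p}`.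
The `i`-th coordinate (`1 ≤ i ≤ n`) is the one with index `i - 1` in `Fin n`. -/
def headTail {n : ℕ} (p : ℝ) (d : Fin n → ℝ) (l : ℕ) : ℝ :=
  (1 / n) * ∑ i ∈ Finset.univ.filter (fun i : Fin n => (i : ℕ) < l), |d i|
    + ((l : ℝ) / n) ^ (1 - 1 / p) * ((1 / n) * ∑ i ∈ Finset.univ.filter (fun i : Fin n => l ≤ (i : ℕ)), |d i| ^ p) ^ (1 / p)

/-- `M` is an Orlicz function related to the vector `d`, with constants `A` and `B`:
`A * headTail p d ℓ ≤ (M^*)⁻¹(ℓ/n) ≤ B * headTail p d ℓ` for `ℓ = 1, …, n`. -/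
structure IsOrliczFunctionOf {n : ℕ} (p A B : ℝ) (d : Fin n → ℝ) (M : ℝ → ℝ) : Prop where
  isOrlicz : IsOrliczFunction M
  lower : ∀ l : ℕ, 1 ≤ l → l ≤ n →
    A * headTail p d l ≤ orliczInv (orliczConj M) ((l : ℝ) / n)
  upper : ∀ l : ℕ, 1 ≤ l → l ≤ n →
    orliczInv (orliczConj M) ((l : ℝ) / n) ≤ B * headTail p d l

/-- The vector with coordinates `((1/k) ∑_{i ≤ k} (x^*_i)^p)^{1/p}`, `k = 1, …, n`. -/
def hardyHead {n : ℕ} (p : ℝ) (x : Fin n → ℝ) (k : Fin n) : ℝ :=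
  ((1 / (((k : ℕ) : ℝ) + 1)) * ∑ i with i ≤ k, |decRearr x i| ^ p) ^ (1 / p)

/-- The vector with coordinates `((1/k) ∑_{i > k} (x^*_i)^2)^{1/2}`, `k = 1, …, n`. -/
def hardyTail {n : ℕ} (x : Fin n → ℝ) (k : Fin n) : ℝ :=
  √((1 / (((k : ℕ) : ℝ) + 1)) * ∑ i with k < i, |decRearr x i| ^ 2)

/-- The vector `z = ((n/i)^{1/p})_{i=1}^n`. -/
def zVec (n : ℕ) (p : ℝ) (i : Fin n) : ℝ :=
  ((n : ℝ) / (((i : ℕ) : ℝ) + 1)) ^ (1 / p)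

/-- The vectors `c^k = (a_k, …, a_k, 0, …, 0)` whose first `⌊n/k⌋` coordinates are `a_k`. -/
def cVec {n : ℕ} (a : Fin n → ℝ) (k j : Fin n) : ℝ :=
  if (j : ℕ) < n / ((k : ℕ) + 1) then a k else 0

/-- The average over all triples of permutations `π, σ, η` of
`(∑_{i,k} |x_i c^k_{π(i)} d_{σ(k)} z_{η(k)}|^2)^{1/2}`. -/
def tripleAverage {n : ℕ} (p : ℝ) (a d x : Fin n → ℝ) : ℝ :=
  (1 / (n.factorial : ℝ) ^ 3) *
    ∑ π : Equiv.Perm (Fin n), ∑ σ : Equiv.Perm (Fin n), ∑ η : Equiv.Perm (Fin n),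
      √(∑ i, ∑ k, |x i * cVec a k (π i) * d (σ k) * zVec n p (η k)| ^ 2)

end

/-! The engine is a formula for averages over permutations. For a nonnegative matrix `b` and `q ≥
1`, the average over `σ` of the `ℓ_q`-norm of `(b k (σ k))_k` is governed by the sum over `k` of the
averages over `j` of `min (b k j) (b k j ^ q)`. The average norm is at most 1 plus this sum
(`permAvg_ellNorm_le`). Conversely, an average norm below 1/16 forces the sum to be at most 1/4
(`sum_min_le_of_permAvg_ellNorm_lt`). The latter rests on a second-moment argument, because the
coordinates of a random permutation are almost independent in pairs.

The formula is used three times. For `d` and `q = p`: by Young's inequality, the relation between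
`M` and `d` says that `M u` is comparable to `truncAvg p (u d)`, up to constants and an error `1/n`.
Summed over `n` coordinates the errors cost only 1. So the Orlicz-Lorentz norm of `x` is equivalent
to the average over `σ` of the `ℓ_p`-norm of `(a_k x*_k d_{σ(k)})_k`. For `z` and `q = 2`: `truncAvg
2 (v z)` is comparable to `v^p`, so averaging over `η` turns `ℓ_2`-norms into `ℓ_p`-norms. For `c^k`
and `q = 2`: if `N_k(π)` is the `ℓ_2`-norm of `x*` on the coordinates selected by `c^k`, its average
is at least `x*_k / 16`.

The triple average is thus equivalent to the average over `π` and `σ` of the `ℓ_p`-norm of `(a_k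
N_k(π) d_{σ(k)})_k`. For the lower bound the triangle inequality moves the average over `π` inside
the norm. For the upper bound Jensen's inequality leaves the `p`-th moment of `N_k`, which is at
most the `p`-th power of `hardyHead + hardyTail` at `k`; the two assumed Hardy inequalities finish.
-/

noncomputable section

/-! ### Averages over the symmetric group -/

/-- The average of a function over all permutations of `Fin n`. -/
def permAvg {n : ℕ} (f : Equiv.Perm (Fin n) → ℝ) : ℝ :=
  (1 / (n.factorial : ℝ)) * ∑ σ, f σ

section permAvg

variable {n : ℕ}

lemma permAvg_mono {f g : Equiv.Perm (Fin n) → ℝ} (h : ∀ σ, f σ ≤ g σ) :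
    permAvg f ≤ permAvg g :=
  mul_le_mul_of_nonneg_left (Finset.sum_le_sum fun σ _ => h σ) (by positivity)

lemma permAvg_nonneg {f : Equiv.Perm (Fin n) → ℝ} (h : ∀ σ, 0 ≤ f σ) : 0 ≤ permAvg f :=
  mul_nonneg (by positivity) (Finset.sum_nonneg fun σ _ => h σ)

lemma permAvg_add (f g : Equiv.Perm (Fin n) → ℝ) :
    permAvg (fun σ => f σ + g σ) = permAvg f + permAvg g := by
  simp [permAvg, Finset.sum_add_distrib, mul_add]

lemma permAvg_sub (f g : Equiv.Perm (Fin n) → ℝ) :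
    permAvg (fun σ => f σ - g σ) = permAvg f - permAvg g := by
  simp [permAvg, Finset.sum_sub_distrib, mul_sub]

lemma permAvg_const_mul (c : ℝ) (f : Equiv.Perm (Fin n) → ℝ) :
    permAvg (fun σ => c * f σ) = c * permAvg f := by
  simp only [permAvg, ← Finset.mul_sum]; ring

lemma permAvg_mul_const (c : ℝ) (f : Equiv.Perm (Fin n) → ℝ) :
    permAvg (fun σ => f σ * c) = permAvg f * c := by
  simp only [permAvg, ← Finset.sum_mul]; ring

lemma permAvg_const (c : ℝ) : permAvg (fun _ : Equiv.Perm (Fin n) => c) = c := by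
  have : (n.factorial : ℝ) ≠ 0 := by positivity
  simp [permAvg, Fintype.card_perm, inv_mul_cancel_left₀ this]

lemma permAvg_sum {ι : Type*} (s : Finset ι) (f : ι → Equiv.Perm (Fin n) → ℝ) :
    permAvg (fun σ => ∑ i ∈ s, f i σ) = ∑ i ∈ s, permAvg (f i) := by
  simp only [permAvg, ← Finset.mul_sum]
  rw [Finset.sum_comm]

lemma permAvg_comm (f : Equiv.Perm (Fin n) → Equiv.Perm (Fin n) → ℝ) :
    permAvg (fun σ => permAvg (f σ)) = permAvg (fun τ => permAvg fun σ => f σ τ) := by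
  simp only [permAvg, ← Finset.mul_sum]
  rw [Finset.sum_comm]

lemma permAvg_mul_right (f : Equiv.Perm (Fin n) → ℝ) (τ : Equiv.Perm (Fin n)) :
    permAvg (fun σ => f (σ * τ)) = permAvg f := by
  unfold permAvg
  congr 1
  exact Equiv.sum_comp (Equiv.mulRight τ) f

/-- Translating by a transposition shows that the average does not depend on `k`, and summing over
all `k` makes each permutation contribute exactly `∑ j, f j`. -/
lemma permAvg_apply (k : Fin n) (f : Fin n → ℝ) :
    permAvg (fun σ => f (σ k)) = (1 / (n : ℝ)) * ∑ j, f j := by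
  have hn : (n : ℝ) ≠ 0 := by
    have := k.pos
    positivity
  have key : ∀ l, permAvg (fun σ => f (σ l)) = permAvg (fun σ => f (σ k)) := fun l => by
    rw [← permAvg_mul_right (fun σ => f (σ k)) (Equiv.swap k l)]
    simp
  have h2 : ∑ l, permAvg (fun σ : Equiv.Perm (Fin n) => f (σ l)) = ∑ j, f j := by
    rw [← permAvg_sum]
    simp_rw [fun σ : Equiv.Perm (Fin n) => Equiv.sum_comp σ f]
    exact permAvg_const _
  simp_rw [key] at h2
  rw [Finset.sum_const, Finset.card_univ, Fintype.card_fin, nsmul_eq_mul] at h2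
  rw [← h2]
  field_simp

lemma exists_perm_of_ne {k l k' l' : Fin n} (h : k ≠ l) (h' : k' ≠ l') :
    ∃ τ : Equiv.Perm (Fin n), τ k = k' ∧ τ l = l' := by
  refine ⟨Equiv.swap (Equiv.swap k k' l) l' * Equiv.swap k k', ?_, by simp⟩
  have h1 : k' ≠ Equiv.swap k k' l := by
    intro h2
    apply h
    have := (Equiv.swap k k').injective ((Equiv.swap_apply_left k k').trans h2)
    exact this
  simp [Equiv.swap_apply_of_ne_of_ne h1 h']

/-- Near-independence of two coordinates. By double transitivity all `n (n - 1)` ordered pairs give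
the same average, and together they contribute at most the full product of sums; the 2 absorbs `n /
(n - 1)`. -/
lemma permAvg_apply_mul_le {k l : Fin n} (hkl : k ≠ l) {f g : Fin n → ℝ}
    (hf : ∀ j, 0 ≤ f j) (hg : ∀ j, 0 ≤ g j) :
    permAvg (fun σ => f (σ k) * g (σ l))
      ≤ 2 * ((1 / (n : ℝ)) * ∑ j, f j) * ((1 / (n : ℝ)) * ∑ j, g j) := by
  have hn2 : 2 ≤ n := by
    have h1 := k.2
    have h2 := l.2
    have h3 : (k : ℕ) ≠ l := fun h => hkl (Fin.ext h)
    omega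
  have hn : (2 : ℝ) ≤ n := by exact_mod_cast hn2
  set V := permAvg (fun σ => f (σ k) * g (σ l)) with hV
  have key : ∀ k' l', k' ≠ l' → permAvg (fun σ => f (σ k') * g (σ l')) = V := by
    intro k' l' h'
    obtain ⟨τ, h1, h2⟩ := exists_perm_of_ne hkl h'
    rw [hV, ← permAvg_mul_right (fun σ => f (σ k) * g (σ l)) τ]
    simp [h1, h2]
  have h1 : ∑ k', ∑ l' ∈ Finset.univ.erase k',
      permAvg (fun σ : Equiv.Perm (Fin n) => f (σ k') * g (σ l')) ≤ (∑ j, f j) * ∑ j, g j := by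
    rw [← permAvg_const (n := n) ((∑ j, f j) * ∑ j, g j)]
    simp_rw [← permAvg_sum]
    refine permAvg_mono fun σ => ?_
    rw [← Equiv.sum_comp σ f, ← Equiv.sum_comp σ g, Finset.sum_mul_sum]
    refine Finset.sum_le_sum fun i _ => ?_
    exact Finset.sum_le_sum_of_subset_of_nonneg (Finset.erase_subset _ _)
      fun j _ _ => mul_nonneg (hf _) (hg _)
  have h2 : ∑ k', ∑ l' ∈ Finset.univ.erase k',
      permAvg (fun σ : Equiv.Perm (Fin n) => f (σ k') * g (σ l')) = n * ((n - 1) * V) := by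
    have : ∀ k' : Fin n, ∑ l' ∈ Finset.univ.erase k',
        permAvg (fun σ : Equiv.Perm (Fin n) => f (σ k') * g (σ l')) = (n - 1) * V := by
      intro k'
      rw [Finset.sum_congr rfl fun l' hl' => key k' l' (Finset.ne_of_mem_erase hl').symm]
      rw [Finset.sum_const, Finset.card_erase_of_mem (Finset.mem_univ _), Finset.card_univ,
        Fintype.card_fin, nsmul_eq_mul, Nat.cast_sub (by omega)]
      simp
    simp_rw [this]
    simp
  have hV0 : 0 ≤ V := permAvg_nonneg fun σ => mul_nonneg (hf _) (hg _)
  rw [h2] at h1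
  have h3 : (n : ℝ) * (n * V) ≤ 2 * ((∑ j, f j) * ∑ j, g j) := by
    nlinarith [mul_nonneg (mul_nonneg (by linarith : (0 : ℝ) ≤ n) hV0)
      (by linarith : (0 : ℝ) ≤ n - 2)]
  have h4 : 2 * ((1 / (n : ℝ)) * ∑ j, f j) * ((1 / (n : ℝ)) * ∑ j, g j)
      = 2 * ((∑ j, f j) * ∑ j, g j) / (n * n) := by field_simp
  rw [h4, le_div_iff₀ (by positivity)]
  linarith

lemma permAvg_rpow_le {f : Equiv.Perm (Fin n) → ℝ} (hf : ∀ σ, 0 ≤ f σ) {r : ℝ} (h0 : 0 ≤ r)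
    (h1 : r ≤ 1) : permAvg (fun σ => f σ ^ r) ≤ permAvg f ^ r := by
  have h := (Real.concaveOn_rpow h0 h1).le_map_sum (t := Finset.univ)
    (w := fun _ : Equiv.Perm (Fin n) => 1 / (n.factorial : ℝ)) (p := f)
    (fun _ _ => by positivity) (by
      have : (n.factorial : ℝ) ≠ 0 := by positivity
      simp [Fintype.card_perm, mul_inv_cancel₀ this]) (fun σ _ => hf σ)
  simpa [permAvg, Finset.mul_sum] using h

end permAvg

/-! ### `ℓ_q`-norms of random vectors -/

/-- The `ℓ_q`-norm of a nonnegative vector. -/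
def ellNorm {n : ℕ} (q : ℝ) (w : Fin n → ℝ) : ℝ := (∑ k, w k ^ q) ^ (1 / q)

section ellNorm

variable {n : ℕ} {q : ℝ} {w v : Fin n → ℝ}

lemma ellNorm_nonneg (hw : ∀ k, 0 ≤ w k) : 0 ≤ ellNorm q w :=
  Real.rpow_nonneg (Finset.sum_nonneg fun k _ => Real.rpow_nonneg (hw k) _) _

lemma ellNorm_rpow (hq : 1 ≤ q) (hw : ∀ k, 0 ≤ w k) : ellNorm q w ^ q = ∑ k, w k ^ q := by
  unfold ellNorm
  rw [← Real.rpow_mul (Finset.sum_nonneg fun k _ => Real.rpow_nonneg (hw k) _),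
    one_div_mul_cancel (by linarith), Real.rpow_one]

lemma ellNorm_mono (hq : 1 ≤ q) (hw : ∀ k, 0 ≤ w k) (h : ∀ k, w k ≤ v k) :
    ellNorm q w ≤ ellNorm q v :=
  Real.rpow_le_rpow (Finset.sum_nonneg fun k _ => Real.rpow_nonneg (hw k) _)
    (Finset.sum_le_sum fun k _ => Real.rpow_le_rpow (hw k) (h k) (by linarith)) (by positivity)

lemma ellNorm_const_mul (hq : 1 ≤ q) {c : ℝ} (hc : 0 ≤ c) (hw : ∀ k, 0 ≤ w k) :
    ellNorm q (fun k => c * w k) = c * ellNorm q w := by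
  unfold ellNorm
  have : ∀ k, (c * w k) ^ q = c ^ q * w k ^ q := fun k => Real.mul_rpow hc (hw k)
  simp_rw [this, ← Finset.mul_sum]
  rw [Real.mul_rpow (by positivity) (Finset.sum_nonneg fun k _ => Real.rpow_nonneg (hw k) _),
    ← Real.rpow_mul hc, mul_one_div_cancel (by linarith), Real.rpow_one]

lemma le_ellNorm (hq : 1 ≤ q) (hw : ∀ k, 0 ≤ w k) (k : Fin n) : w k ≤ ellNorm q w := by
  have h : w k ^ q ≤ ∑ l, w l ^ q :=
    Finset.single_le_sum (f := fun l => w l ^ q) (fun l _ => Real.rpow_nonneg (hw l) _)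
      (Finset.mem_univ k)
  rw [← ellNorm_rpow hq hw] at h
  exact (Real.rpow_le_rpow_iff (hw k) (ellNorm_nonneg hw) (by linarith)).1 h

lemma ellNorm_add_le (hq : 1 ≤ q) (hw : ∀ k, 0 ≤ w k) (hv : ∀ k, 0 ≤ v k) :
    ellNorm q (fun k => w k + v k) ≤ ellNorm q w + ellNorm q v :=
  Real.Lp_add_le_of_nonneg _ hq (fun k _ => hw k) fun k _ => hv k

lemma ellNorm_zero (hq : 1 ≤ q) : ellNorm q (fun _ : Fin n => 0) = 0 := by
  unfold ellNorm
  rw [Finset.sum_eq_zero fun k _ => Real.zero_rpow (by linarith), Real.zero_rpow]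
  have : 0 < q := by linarith
  positivity

lemma ellNorm_sum_le {ι : Type*} (hq : 1 ≤ q) (s : Finset ι) {f : ι → Fin n → ℝ}
    (hf : ∀ i k, 0 ≤ f i k) : ellNorm q (fun k => ∑ i ∈ s, f i k) ≤ ∑ i ∈ s, ellNorm q (f i) := by
  classical
  induction s using Finset.induction_on with
  | empty => simp [ellNorm_zero hq]
  | insert i s hi ih =>
    simp_rw [Finset.sum_insert hi]
    exact (ellNorm_add_le hq (hf i) fun k => Finset.sum_nonneg fun j _ => hf j k).trans
      (by linarith)

lemma ellNorm_permAvg_le (hq : 1 ≤ q) {f : Equiv.Perm (Fin n) → Fin n → ℝ}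
    (hf : ∀ σ k, 0 ≤ f σ k) :
    ellNorm q (fun k => permAvg fun σ => f σ k) ≤ permAvg fun σ => ellNorm q (f σ) := by
  unfold permAvg
  rw [ellNorm_const_mul hq (by positivity) fun k => Finset.sum_nonneg fun σ _ => hf σ k]
  exact mul_le_mul_of_nonneg_left (ellNorm_sum_le hq _ hf) (by positivity)

/-- Split `w` at height 1. The small part has norm `t ≤ 1 + t ^ q`, and the large part is bounded by
its `ℓ_1`-norm. -/
lemma ellNorm_le_one_add (hq : 1 ≤ q) (hw : ∀ k, 0 ≤ w k) :
    ellNorm q w ≤ 1 + ∑ k, min (w k) (w k ^ q) := by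
  have hsplit : ∀ k, w k = (if w k ≤ 1 then w k else 0) + if w k ≤ 1 then 0 else w k := by
    intro k; split_ifs <;> simp
  have h1 : ellNorm q w ≤ ellNorm q (fun k => if w k ≤ 1 then w k else 0)
      + ellNorm q (fun k => if w k ≤ 1 then 0 else w k) := by
    conv_lhs => rw [show w = fun k => _ from funext hsplit]
    refine ellNorm_add_le hq (fun k => ?_) fun k => ?_ <;> split_ifs <;> simp [hw]
  have hs : ∀ k, 0 ≤ if w k ≤ 1 then w k else 0 := fun k => by split_ifs <;> simp [hw]
  have h2 : ellNorm q (fun k => if w k ≤ 1 then w k else 0)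
      ≤ 1 + ∑ k, (if w k ≤ 1 then w k else 0) ^ q := by
    rw [← ellNorm_rpow hq hs]
    set t := ellNorm q (fun k => if w k ≤ 1 then w k else 0)
    have ht : 0 ≤ t := ellNorm_nonneg hs
    rcases le_total t 1 with h | h
    · have := Real.rpow_nonneg ht q
      linarith
    · have := Real.rpow_le_rpow_of_exponent_le h hq
      rw [Real.rpow_one] at this
      linarith
  have h3 : ellNorm q (fun k => if w k ≤ 1 then 0 else w k)
      ≤ ∑ k, if w k ≤ 1 then 0 else w k := by
    have e : (fun k => if w k ≤ 1 then 0 else w k)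
        = fun k => ∑ i, Pi.single (M := fun _ => ℝ) i (if w i ≤ 1 then 0 else w i) k := by
      funext k
      simp [Pi.single_apply]
    conv_lhs => rw [e]
    refine (ellNorm_sum_le hq _ fun i k => ?_).trans (Finset.sum_le_sum fun i _ => ?_)
    · rw [Pi.single_apply]
      split_ifs <;> simp [hw]
    · have hu : 0 ≤ if w i ≤ 1 then 0 else w i := by split_ifs <;> simp [hw]
      generalize (if w i ≤ 1 then 0 else w i) = u at hu
      unfold ellNorm
      rw [Finset.sum_eq_single i]
      · rw [Pi.single_eq_same, ← Real.rpow_mul hu, mul_one_div_cancel (by linarith),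
          Real.rpow_one]
      · intro b _ hb
        rw [Pi.single_eq_of_ne hb, Real.zero_rpow (by linarith)]
      · simp
  have h4 : ∑ k, (if w k ≤ 1 then w k else 0) ^ q + ∑ k, (if w k ≤ 1 then 0 else w k)
      ≤ ∑ k, min (w k) (w k ^ q) := by
    rw [← Finset.sum_add_distrib]
    refine Finset.sum_le_sum fun k _ => ?_
    split_ifs with h
    · rw [add_zero, le_min_iff]
      refine ⟨?_, le_rfl⟩
      simpa using Real.rpow_le_rpow_of_exponent_ge' (hw k) h zero_le_one hq
    · rw [Real.zero_rpow (by linarith), zero_add, le_min_iff]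
      refine ⟨le_rfl, ?_⟩
      simpa using Real.rpow_le_rpow_of_exponent_le (not_le.1 h).le hq
  linarith

/-- A pointwise lower bound whose average involves only pairs of coordinates. Let `N` be the norm.
If `N ≤ 1`, the left side is at most `N ^ q ≤ N`. If `N ≥ 1`, then `min (w k) (w k ^ q) ≤ min 1 (w k
^ q) * N`. Either some erased sum is below `s`, so the full sum is at most `s + 1 ≤ 2 s`, or every
term on the left is nonpositive. -/
lemma sum_min_mul_le_two_mul_ellNorm (hq : 1 ≤ q) (hw : ∀ k, 0 ≤ w k) {s : ℝ} (hs : 1 ≤ s) :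
    ∑ k, min (w k) (w k ^ q) / s * (1 - (∑ l ∈ Finset.univ.erase k, min 1 (w l ^ q)) / s)
      ≤ 2 * ellNorm q w := by
  have hs0 : 0 < s := by linarith
  have hN := ellNorm_nonneg (q := q) hw
  have hh0 : ∀ k, 0 ≤ min 1 (w k ^ q) := fun k => le_min zero_le_one (Real.rpow_nonneg (hw k) _)
  have hg0 : ∀ k, 0 ≤ min (w k) (w k ^ q) := fun k => le_min (hw k) (Real.rpow_nonneg (hw k) _)
  have hterm : ∀ k, min (w k) (w k ^ q) / s
      * (1 - (∑ l ∈ Finset.univ.erase k, min 1 (w l ^ q)) / s) ≤ min (w k) (w k ^ q) / s := by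
    intro k
    refine mul_le_of_le_one_right (div_nonneg (hg0 k) hs0.le) ?_
    have : 0 ≤ (∑ l ∈ Finset.univ.erase k, min 1 (w l ^ q)) / s :=
      div_nonneg (Finset.sum_nonneg fun l _ => hh0 l) hs0.le
    linarith
  rcases le_total (ellNorm q w) 1 with h1 | h1
  · calc _ ≤ ∑ k, w k ^ q := by
          refine Finset.sum_le_sum fun k _ => (hterm k).trans ?_
          exact (div_le_self (hg0 k) hs).trans (min_le_right _ _)
      _ = ellNorm q w ^ q := (ellNorm_rpow hq hw).symm
      _ ≤ ellNorm q w := by simpa using Real.rpow_le_rpow_of_exponent_ge' hN h1 zero_le_one hq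
      _ ≤ 2 * ellNorm q w := by linarith
  · have hgh : ∀ k, min (w k) (w k ^ q) ≤ min 1 (w k ^ q) * ellNorm q w := by
      intro k
      rcases le_total (w k) 1 with h | h
      · have : w k ^ q ≤ 1 := Real.rpow_le_one (hw k) h (by linarith)
        rw [min_eq_right this]
        exact (min_le_right _ _).trans (le_mul_of_one_le_right (Real.rpow_nonneg (hw k) _) h1)
      · have : 1 ≤ w k ^ q := Real.one_le_rpow h (by linarith)
        rw [min_eq_left this, one_mul]
        exact (min_le_left _ _).trans (le_ellNorm hq hw k)
    by_cases hex : ∃ k, ∑ l ∈ Finset.univ.erase k, min 1 (w l ^ q) < s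
    · obtain ⟨k₀, hk₀⟩ := hex
      have hX : ∑ k, min 1 (w k ^ q) ≤ 2 * s := by
        rw [← Finset.add_sum_erase _ _ (Finset.mem_univ k₀)]
        have := min_le_left 1 (w k₀ ^ q)
        linarith
      calc _ ≤ ∑ k, min 1 (w k ^ q) * (ellNorm q w / s) := by
            refine Finset.sum_le_sum fun k _ => (hterm k).trans ?_
            rw [← mul_div_assoc]
            exact div_le_div_of_nonneg_right (hgh k) hs0.le
        _ = (∑ k, min 1 (w k ^ q)) * (ellNorm q w / s) := by rw [Finset.sum_mul]
        _ ≤ 2 * s * (ellNorm q w / s) := mul_le_mul_of_nonneg_right hX (by positivity)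
        _ = 2 * ellNorm q w := by field_simp
    · push Not at hex
      refine (Finset.sum_nonpos fun k _ => ?_).trans (by positivity)
      refine mul_nonpos_of_nonneg_of_nonpos (div_nonneg (hg0 k) hs0.le) ?_
      have := (one_le_div hs0).2 (hex k)
      linarith

lemma permAvg_ellNorm_le (hq : 1 ≤ q) {b : Fin n → Fin n → ℝ} (hb : ∀ k j, 0 ≤ b k j) :
    permAvg (fun σ => ellNorm q fun k => b k (σ k))
      ≤ 1 + ∑ k, (1 / (n : ℝ)) * ∑ j, min (b k j) (b k j ^ q) := by
  calc _ ≤ permAvg (fun σ => 1 + ∑ k, min (b k (σ k)) (b k (σ k) ^ q)) :=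
        permAvg_mono fun σ => ellNorm_le_one_add hq fun k => hb _ _
    _ = _ := by
      rw [permAvg_add, permAvg_const, permAvg_sum]
      congr 1
      refine Finset.sum_congr rfl fun k _ => ?_
      rw [permAvg_apply k fun j => min (b k j) (b k j ^ q)]

lemma sum_min_le_of_permAvg_ellNorm_lt (hq : 1 ≤ q) {b : Fin n → Fin n → ℝ}
    (hb : ∀ k j, 0 ≤ b k j) (h : permAvg (fun σ => ellNorm q fun k => b k (σ k)) < 1 / 16) :
    ∑ k, (1 / (n : ℝ)) * ∑ j, min (b k j) (b k j ^ q) ≤ 1 / 4 := by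
  set G := ∑ k, (1 / (n : ℝ)) * ∑ j, min (b k j) (b k j ^ q) with hG
  set H := ∑ k, (1 / (n : ℝ)) * ∑ j, min 1 (b k j ^ q) with hH
  have hr : ∀ k j, 0 ≤ b k j ^ q := fun k j => Real.rpow_nonneg (hb k j) _
  have hg0 : ∀ k j, 0 ≤ min (b k j) (b k j ^ q) := fun k j => le_min (hb k j) (hr k j)
  have hh0 : ∀ k j, 0 ≤ min 1 (b k j ^ q) := fun k j => le_min zero_le_one (hr k j)
  have hHG : H ≤ G := by
    refine Finset.sum_le_sum fun k _ => mul_le_mul_of_nonneg_left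
      (Finset.sum_le_sum fun j _ => ?_) (by positivity)
    rw [le_min_iff]
    refine ⟨?_, min_le_right _ _⟩
    rcases le_total (b k j) 1 with h1 | h1
    · exact (min_le_right _ _).trans
        (by simpa using Real.rpow_le_rpow_of_exponent_ge' (hb k j) h1 zero_le_one hq)
    · exact (min_le_left _ _).trans h1
  have hG0 : 0 ≤ G := Finset.sum_nonneg fun k _ => mul_nonneg (by positivity)
    (Finset.sum_nonneg fun j _ => hg0 k j)
  have hH0 : 0 ≤ H := Finset.sum_nonneg fun k _ => mul_nonneg (by positivity)
    (Finset.sum_nonneg fun j _ => hh0 k j)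
  have key : ∀ s : ℝ, 1 ≤ s →
      G / s * (1 - 2 * H / s) ≤ 2 * permAvg (fun σ => ellNorm q fun k => b k (σ k)) := by
    intro s hs
    have hs0 : 0 < s := by linarith
    rw [← permAvg_const_mul]
    refine le_trans ?_ (permAvg_mono fun σ =>
      sum_min_mul_le_two_mul_ellNorm hq (fun k => hb k (σ k)) hs)
    rw [permAvg_sum]
    have e1 : G / s * (1 - 2 * H / s) = ∑ k, (((1 / (n : ℝ)) * ∑ j, min (b k j) (b k j ^ q)) / s
        - 2 * ((1 / (n : ℝ)) * ∑ j, min (b k j) (b k j ^ q)) * H / s ^ 2) := by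
      have e0 : ∀ f : Fin n → ℝ, (∑ k, f k) / s * (1 - 2 * H / s)
          = ∑ k, (f k / s - 2 * f k * H / s ^ 2) := by
        intro f
        rw [Finset.sum_sub_distrib, ← Finset.sum_div, ← Finset.sum_div, ← Finset.sum_mul,
          ← Finset.mul_sum]
        field_simp
      exact e0 _
    rw [e1]
    refine Finset.sum_le_sum fun k _ => ?_
    have e2 : (fun σ : Equiv.Perm (Fin n) => min (b k (σ k)) (b k (σ k) ^ q) / s
        * (1 - (∑ l ∈ Finset.univ.erase k, min 1 (b l (σ l) ^ q)) / s))
        = fun σ => min (b k (σ k)) (b k (σ k) ^ q) * s⁻¹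
          - (∑ l ∈ Finset.univ.erase k,
            min (b k (σ k)) (b k (σ k) ^ q) * min 1 (b l (σ l) ^ q)) * (s ^ 2)⁻¹ := by
      funext σ
      rw [← Finset.mul_sum]
      field_simp
    rw [e2, permAvg_sub, permAvg_mul_const, permAvg_mul_const,
      permAvg_apply k fun j => min (b k j) (b k j ^ q), permAvg_sum]
    rw [← div_eq_mul_inv, ← div_eq_mul_inv]
    refine sub_le_sub_left (div_le_div_of_nonneg_right ?_ (by positivity)) _
    calc _ ≤ ∑ l ∈ Finset.univ.erase k, 2 * ((1 / (n : ℝ)) * ∑ j, min (b k j) (b k j ^ q))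
            * ((1 / (n : ℝ)) * ∑ j, min 1 (b l j ^ q)) := by
          refine Finset.sum_le_sum fun l hl => ?_
          exact permAvg_apply_mul_le (Finset.ne_of_mem_erase hl).symm
            (f := fun j => min (b k j) (b k j ^ q)) (g := fun j => min 1 (b l j ^ q))
            (hg0 k) (hh0 l)
      _ ≤ ∑ l, 2 * ((1 / (n : ℝ)) * ∑ j, min (b k j) (b k j ^ q))
            * ((1 / (n : ℝ)) * ∑ j, min 1 (b l j ^ q)) := by
          refine Finset.sum_le_sum_of_subset_of_nonneg (Finset.erase_subset _ _) fun l _ _ => ?_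
          have h1 := Finset.sum_nonneg fun j (_ : j ∈ Finset.univ) => hg0 k j
          have h2 := Finset.sum_nonneg fun j (_ : j ∈ Finset.univ) => hh0 l j
          positivity
      _ = _ := by rw [← Finset.mul_sum]
  -- The scale `s` keeps `2 H / s ≤ 1 / 2`: take `s = 1` when `H` is small, and `s = 4 H` otherwise.
  -- In the second case `H ≤ G` would make the average at least 1/16.
  rcases le_total H (1 / 4) with hle | hge
  · have := key 1 le_rfl
    simp only [div_one] at this
    nlinarith
  · have h4 : 1 ≤ 4 * H := by linarith
    have h5 := key (4 * H) h4
    have e : 2 * H / (4 * H) = 1 / 2 := by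
      have : H ≠ 0 := by linarith
      field_simp; norm_num
    rw [e] at h5
    have h6 : 1 / 4 ≤ G / (4 * H) := by
      rw [le_div_iff₀ (by linarith)]; linarith
    linarith

end ellNorm

/-! ### Orlicz functions and their conjugates -/

namespace IsOrliczFunction

variable {M : ℝ → ℝ} (hM : IsOrliczFunction M)

include hM

lemma nonneg {t : ℝ} (ht : 0 ≤ t) : 0 ≤ M t := by
  rcases ht.eq_or_lt with rfl | h
  · exact hM.map_zero.ge
  · exact (hM.pos t h).le

lemma map_mul_le {c t : ℝ} (hc : 0 ≤ c) (hc1 : c ≤ 1) (ht : 0 ≤ t) : M (c * t) ≤ c * M t := by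
  have := hM.convexOn.2 (Set.mem_Ici.2 ht) (Set.mem_Ici.2 le_rfl) hc (sub_nonneg.2 hc1)
    (by ring)
  simpa [hM.map_zero] using this

lemma bddAbove_image (x : ℝ) : BddAbove ((fun t => x * t - M t) '' Set.Ici 0) := by
  obtain ⟨T, hT⟩ := (hM.tendsto_atTop.eventually (eventually_ge_atTop x)).exists_forall_of_atTop
  refine ⟨|x| * max T 1, ?_⟩
  rintro _ ⟨t, ht, rfl⟩
  have ht0 : (0 : ℝ) ≤ t := ht
  have hMt := hM.nonneg ht0
  have hpos : 0 ≤ |x| * max T 1 := by positivity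
  rcases le_total t (max T 1) with h | h
  · have h1 : x * t ≤ |x| * max T 1 :=
      (mul_le_mul_of_nonneg_right (le_abs_self x) ht0).trans
        (mul_le_mul_of_nonneg_left h (abs_nonneg x))
    simp only
    linarith
  · have ht1 : 0 < t := by linarith [le_max_right T 1]
    have := hT t ((le_max_left _ _).trans h)
    rw [le_div_iff₀ ht1] at this
    simp only
    linarith

lemma mul_sub_le_conj (x : ℝ) {t : ℝ} (ht : 0 ≤ t) : x * t - M t ≤ orliczConj M x :=
  le_csSup (hM.bddAbove_image x) ⟨t, ht, rfl⟩

omit hM in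
lemma conj_le {x c : ℝ} (h : ∀ t, 0 ≤ t → x * t - M t ≤ c) : orliczConj M x ≤ c := by
  refine csSup_le ⟨_, 0, Set.mem_Ici.2 le_rfl, rfl⟩ ?_
  rintro _ ⟨t, ht, rfl⟩
  exact h t ht

lemma conj_nonneg (x : ℝ) : 0 ≤ orliczConj M x := by
  simpa [hM.map_zero] using hM.mul_sub_le_conj x le_rfl

lemma conj_zero : orliczConj M 0 = 0 :=
  le_antisymm (conj_le fun t ht => by simpa using hM.nonneg ht) (hM.conj_nonneg 0)

lemma conj_mono : Monotone (orliczConj M) := fun x y hxy => conj_le fun t ht =>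
  le_trans (by nlinarith) (hM.mul_sub_le_conj y ht)

lemma conj_mul_le {c y : ℝ} (hc : 0 ≤ c) (hc1 : c ≤ 1) :
    orliczConj M (c * y) ≤ c * orliczConj M y := by
  refine conj_le fun t ht => ?_
  have h1 := hM.mul_sub_le_conj y ht
  have h2 := hM.nonneg ht
  nlinarith

lemma convexOn_conj : ConvexOn ℝ Set.univ (orliczConj M) := by
  refine ⟨convex_univ, fun x _ y _ a b ha hb hab => conj_le fun t ht => ?_⟩
  have h1 := mul_le_mul_of_nonneg_left (hM.mul_sub_le_conj x ht) ha
  have h2 := mul_le_mul_of_nonneg_left (hM.mul_sub_le_conj y ht) hb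
  have h3 : M t = (a + b) * M t := by rw [hab, one_mul]
  simp only [smul_eq_mul]
  linarith

/-- Ensures that `invFunOn` returns a genuine preimage: the conjugate is continuous, vanishes at 0,
and is at least `s` at `s + M 1`, as testing with `t = 1` shows. -/
lemma conj_invFun {s : ℝ} (hs : 0 ≤ s) :
    0 ≤ orliczInv (orliczConj M) s ∧ orliczConj M (orliczInv (orliczConj M) s) = s := by
  have hcont : ContinuousOn (orliczConj M) (Set.Icc 0 (s + M 1)) :=
    (hM.convexOn_conj.continuousOn isOpen_univ).mono (Set.subset_univ _)
  have h0 : 0 ≤ s + M 1 := add_nonneg hs (hM.nonneg zero_le_one)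
  have hmem : s ∈ Set.Icc (orliczConj M 0) (orliczConj M (s + M 1)) := by
    refine ⟨by rwa [hM.conj_zero], ?_⟩
    have := hM.mul_sub_le_conj (s + M 1) zero_le_one
    linarith
  obtain ⟨y, hy, hys⟩ := intermediate_value_Icc h0 hcont hmem
  have hex : ∃ y ∈ Set.Ici (0 : ℝ), orliczConj M y = s := ⟨y, hy.1, hys⟩
  exact ⟨Function.invFunOn_mem hex, Function.invFunOn_eq hex⟩

/-- A convex function vanishing at 0 is strictly increasing beyond any point where it is positive;
this is why `s` must be positive. -/
lemma le_invFun {s y : ℝ} (hs : 0 < s) (hy : orliczConj M y ≤ s) :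
    y ≤ orliczInv (orliczConj M) s := by
  obtain ⟨h0, h1⟩ := hM.conj_invFun hs.le
  by_contra! hlt
  have hypos : 0 < y := h0.trans_lt hlt
  have h2 := hM.conj_mul_le (c := orliczInv (orliczConj M) s / y) (y := y)
    (div_nonneg h0 hypos.le) ((div_le_one hypos).2 hlt.le)
  rw [div_mul_cancel₀ _ hypos.ne', h1] at h2
  have h3 : orliczInv (orliczConj M) s / y < 1 := (div_lt_one hypos).2 hlt
  have h4 : orliczInv (orliczConj M) s / y * orliczConj M y
      ≤ orliczInv (orliczConj M) s / y * s :=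
    mul_le_mul_of_nonneg_left hy (div_nonneg h0 hypos.le)
  nlinarith

/-- Equality in Young's inequality: `y` is the slope of a supporting line of `M` at `u`. -/
lemma exists_conj_eq {u : ℝ} (hu : 0 ≤ u) : ∃ y, 0 ≤ y ∧ orliczConj M y = y * u - M u := by
  rcases hu.eq_or_lt with rfl | hu
  · exact ⟨0, le_rfl, by simp [hM.conj_zero, hM.map_zero]⟩
  have hint : u ∈ interior (Set.Ici (0 : ℝ)) := by rwa [interior_Ici, Set.mem_Ioi]
  set y := derivWithin M (Set.Ioi u) u with hy
  have key : ∀ t, 0 ≤ t → y * t - M t ≤ y * u - M u := by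
    intro t ht
    rcases lt_trichotomy t u with h | rfl | h
    · have h1 := (hM.convexOn.slope_le_leftDeriv_of_mem_interior ht hint h).trans
        (hM.convexOn.leftDeriv_le_rightDeriv_of_mem_interior hint)
      rw [← hy, slope_def_field, div_le_iff₀ (by linarith)] at h1
      linarith
    · exact le_rfl
    · have h1 := hM.convexOn.rightDeriv_le_slope_of_mem_interior hint ht h
      rw [← hy, slope_def_field, le_div_iff₀ (by linarith)] at h1
      linarith
  have h0 := key 0 le_rfl
  have hMu := hM.pos u hu
  rw [hM.map_zero] at h0
  refine ⟨y, ?_, le_antisymm (conj_le key) (hM.mul_sub_le_conj y hu.le)⟩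
  have : 0 ≤ y * u := by linarith
  exact nonneg_of_mul_nonneg_left this hu

end IsOrliczFunction

/-! ### Comparison of `headTail` with truncated averages -/

/-- The average of `min (e j) (e j ^ q)`. -/
def truncAvg {n : ℕ} (q : ℝ) (e : Fin n → ℝ) : ℝ := (1 / (n : ℝ)) * ∑ j, min (e j) (e j ^ q)

section headTail

variable {n : ℕ} {p : ℝ} {e : Fin n → ℝ}

lemma truncAvg_nonneg (he : ∀ j, 0 ≤ e j) : 0 ≤ truncAvg p e :=
  mul_nonneg (by positivity)
    (Finset.sum_nonneg fun j _ => le_min (he j) (Real.rpow_nonneg (he j) _))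

lemma mul_headTail (hp : 1 < p) (d : Fin n → ℝ) {v : ℝ} (hv : 0 ≤ v) (l : ℕ) :
    v * headTail p d l = headTail p (fun j => v * d j) l := by
  unfold headTail
  have hp0 : p ≠ 0 := by linarith
  have h1 : ∀ j, |v * d j| = v * |d j| := fun j => by rw [abs_mul, abs_of_nonneg hv]
  have h2 : ∀ j, (v * |d j|) ^ p = v ^ p * |d j| ^ p := fun j => Real.mul_rpow hv (abs_nonneg _)
  simp_rw [h1, h2, ← Finset.mul_sum]
  have hS : 0 ≤ 1 / (n : ℝ) * ∑ i ∈ Finset.univ.filter (fun i : Fin n => l ≤ (i : ℕ)), |d i| ^ p := by positivity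
  rw [mul_left_comm (1 / (n : ℝ)) (v ^ p), Real.mul_rpow (by positivity) hS, ← Real.rpow_mul hv,
    mul_one_div_cancel hp0, Real.rpow_one]
  ring

lemma sum_filter_lt_add_sum_filter_ge (f : Fin n → ℝ) (m : ℕ) :
    ∑ i ∈ Finset.univ.filter (fun i : Fin n => (i : ℕ) < m), f i + ∑ i ∈ Finset.univ.filter (fun i : Fin n => m ≤ (i : ℕ)), f i = ∑ i, f i := by
  rw [← Finset.sum_filter_add_sum_filter_not Finset.univ (fun i : Fin n => (i : ℕ) < m) f]
  simp only [not_lt]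

/-- Cut at the index `m` with `m / n` just above the truncated average `T`. Before `m` use `min ≤
e`. After `m` the truncated part `H` is at most both `m / n` and the average of `e ^ p` there, so `H
= H ^ (1 - 1/p) * H ^ (1/p)` is at most the tail term. If `m` is capped at `n`, the tail is empty.
-/
lemma exists_truncAvg_le_headTail (hn : 0 < n) (hp : 1 < p) (he : ∀ j, 0 ≤ e j) :
    ∃ m : ℕ, 1 ≤ m ∧ m ≤ n ∧ (m : ℝ) / n ≤ truncAvg p e + 1 / n ∧
      truncAvg p e ≤ headTail p e m := by
  have hn' : (0 : ℝ) < n := by exact_mod_cast hn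
  set T := truncAvg p e with hT
  have hT0 : 0 ≤ T := truncAvg_nonneg he
  have hr : ∀ j, 0 ≤ e j ^ p := fun j => Real.rpow_nonneg (he j) _
  refine ⟨min n (⌊n * T⌋₊ + 1), by omega, min_le_left _ _, ?_, ?_⟩
  · rw [div_le_iff₀ hn', add_mul, one_div_mul_cancel hn'.ne']
    have h1 : ((min n (⌊n * T⌋₊ + 1) : ℕ) : ℝ) ≤ ((⌊n * T⌋₊ + 1 : ℕ) : ℝ) := by
      exact_mod_cast min_le_right _ _
    have h2 := Nat.floor_le (mul_nonneg hn'.le hT0)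
    push_cast at h1
    push_cast
    linarith
  · set m := min n (⌊n * T⌋₊ + 1) with hm
    set H1 := (1 / (n : ℝ)) * ∑ i ∈ Finset.univ.filter (fun i : Fin n => (i : ℕ) < m), min (e i) (e i ^ p) with hH1
    set H2 := (1 / (n : ℝ)) * ∑ i ∈ Finset.univ.filter (fun i : Fin n => m ≤ (i : ℕ)), min (e i) (e i ^ p) with hH2
    have hg0 : ∀ j, 0 ≤ min (e j) (e j ^ p) := fun j => le_min (he j) (hr j)
    have hsum : H1 + H2 = T := by
      rw [hH1, hH2, ← mul_add, sum_filter_lt_add_sum_filter_ge, hT, truncAvg]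
    have hH10 : 0 ≤ H1 := mul_nonneg (by positivity) (Finset.sum_nonneg fun j _ => hg0 j)
    have hH20 : 0 ≤ H2 := mul_nonneg (by positivity) (Finset.sum_nonneg fun j _ => hg0 j)
    have hmH : H2 ≤ (m : ℝ) / n := by
      rcases le_total n (⌊n * T⌋₊ + 1) with h | h
      · have : m = n := min_eq_left h
        have hz : H2 = 0 := by
          rw [hH2, this, Finset.filter_false_of_mem fun i _ => not_le.2 i.2]
          simp
        rw [hz]; positivity
      · have : m = ⌊n * T⌋₊ + 1 := min_eq_right h
        rw [this, le_div_iff₀ hn']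
        have := (Nat.lt_floor_add_one (n * T)).le
        push_cast
        nlinarith
    rw [← hsum]
    unfold headTail
    refine add_le_add (mul_le_mul_of_nonneg_left (Finset.sum_le_sum fun j _ => ?_)
      (by positivity)) ?_
    · rw [abs_of_nonneg (he j)]; exact min_le_left _ _
    · have hp0 : 0 < p := by linarith
      have hexp : 0 ≤ 1 - 1 / p := by
        rw [sub_nonneg, div_le_one hp0]; exact hp.le
      calc H2 = H2 ^ (1 - 1 / p) * H2 ^ (1 / p) := by
            rw [← Real.rpow_add_of_nonneg hH20 hexp (by positivity)]
            simp
        _ ≤ _ := by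
            refine mul_le_mul (Real.rpow_le_rpow hH20 hmH hexp)
              (Real.rpow_le_rpow hH20 ?_ (by positivity)) (by positivity) (by positivity)
            refine mul_le_mul_of_nonneg_left (Finset.sum_le_sum fun j _ => ?_) (by positivity)
            rw [abs_of_nonneg (he j)]; exact min_le_right _ _

lemma le_min_rpow_add_one (hp : 1 < p) {t : ℝ} (ht : 0 ≤ t) : t ≤ min t (t ^ p) + 1 := by
  rcases le_total t 1 with h | h
  · have : 0 ≤ min t (t ^ p) := le_min ht (Real.rpow_nonneg ht _)
    linarith
  · have : t ≤ t ^ p := by simpa using Real.rpow_le_rpow_of_exponent_le h hp.le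
    rw [min_eq_left this]; linarith

lemma card_filter_lt {l : ℕ} (hl : l ≤ n) :
    (Finset.univ.filter fun i : Fin n => (i : ℕ) < l).card = l := by
  rw [Fin.card_filter_val_lt, min_eq_right hl]

lemma head_le_truncAvg_add (hn : 0 < n) (hp : 1 < p) (he : ∀ j, 0 ≤ e j) {l : ℕ} (hl : l ≤ n) :
    (1 / (n : ℝ)) * ∑ i ∈ Finset.univ.filter (fun i : Fin n => (i : ℕ) < l), |e i| ≤ truncAvg p e + (l : ℝ) / n := by
  have hg0 : ∀ j, 0 ≤ min (e j) (e j ^ p) := fun j => le_min (he j) (Real.rpow_nonneg (he j) _)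
  have h1 : ∑ i ∈ Finset.univ.filter (fun i : Fin n => (i : ℕ) < l), |e i| ≤ ∑ j, min (e j) (e j ^ p) + l := by
    calc _ ≤ ∑ i ∈ Finset.univ.filter (fun i : Fin n => (i : ℕ) < l), (min (e i) (e i ^ p) + 1) :=
          Finset.sum_le_sum fun i _ => by
            rw [abs_of_nonneg (he i)]; exact le_min_rpow_add_one hp (he i)
      _ = ∑ i ∈ Finset.univ.filter (fun i : Fin n => (i : ℕ) < l), min (e i) (e i ^ p) + l := by
          rw [Finset.sum_add_distrib]; simp [card_filter_lt hl]
      _ ≤ _ := by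
          gcongr
          · exact fun j _ _ => hg0 j
          · exact Finset.filter_subset _ _
  calc _ ≤ (1 / (n : ℝ)) * (∑ j, min (e j) (e j ^ p) + l) :=
        mul_le_mul_of_nonneg_left h1 (by positivity)
    _ = _ := by rw [truncAvg]; ring

lemma headTail_self_le (hn : 0 < n) (hp : 1 < p) (he : ∀ j, 0 ≤ e j) :
    headTail p e n ≤ truncAvg p e + 1 := by
  have hn' : (n : ℝ) ≠ 0 := by positivity
  have h := head_le_truncAvg_add hn hp he le_rfl
  rw [div_self hn'] at h
  unfold headTail
  rw [Finset.filter_false_of_mem (p := fun i : Fin n => n ≤ (i : ℕ)) fun i _ => not_le.2 i.2,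
    Finset.sum_empty, mul_zero, Real.zero_rpow, mul_zero, add_zero]
  · exact h
  · have : 0 < p := by linarith
    positivity

/-- Let `a = l / n` and let `S` be the head term, at most `R = T + a`. By monotonicity the entries
after `l` are at most `S / a`, so there `e ^ p` exceeds the truncation by a factor of at most `1 +
(S / a) ^ (p - 1)`. The tail term is then at most `2 R`. -/
lemma headTail_le (hp : 1 < p) (he : ∀ j, 0 ≤ e j) (hanti : Antitone e) {l : ℕ}
    (hl1 : 1 ≤ l) (hl : l ≤ n) : headTail p e l ≤ 3 * (truncAvg p e + (l : ℝ) / n) := by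
  have hn : 0 < n := by omega
  have hn' : (0 : ℝ) < n := by exact_mod_cast hn
  have hl' : (0 : ℝ) < l := by exact_mod_cast hl1
  have hp0 : 0 < p := by linarith
  have hhead := head_le_truncAvg_add hn hp he hl
  set T := truncAvg p e with hT
  set a := (l : ℝ) / n with ha
  have ha0 : 0 < a := by positivity
  have hT0 : 0 ≤ T := truncAvg_nonneg he
  set S := (1 / (n : ℝ)) * ∑ i ∈ Finset.univ.filter (fun i : Fin n => (i : ℕ) < l), |e i| with hS
  have hS0 : 0 ≤ S := by positivity
  have hr : ∀ j, 0 ≤ e j ^ p := fun j => Real.rpow_nonneg (he j) _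
  have hg0 : ∀ j, 0 ≤ min (e j) (e j ^ p) := fun j => le_min (he j) (hr j)
  have hD : ∀ j : Fin n, l ≤ (j : ℕ) → e j ≤ S / a := by
    intro j hj
    have h1 : (l : ℝ) * e j ≤ ∑ i ∈ Finset.univ.filter (fun i : Fin n => (i : ℕ) < l), |e i| := by
      have : ∑ i ∈ Finset.univ.filter (fun i : Fin n => (i : ℕ) < l), e j = l * e j := by simp [card_filter_lt hl]
      rw [← this]
      refine Finset.sum_le_sum fun i hi => ?_
      rw [abs_of_nonneg (he i)]
      refine hanti (Fin.le_def.2 ?_)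
      have := (Finset.mem_filter.1 hi).2
      omega
    rw [le_div_iff₀ ha0, hS, ha, mul_div_assoc', div_le_iff₀ hn']
    calc e j * l = l * e j := mul_comm _ _
      _ ≤ _ := h1
      _ = _ := by field_simp
  have hbound : ∀ j : Fin n, l ≤ (j : ℕ) →
      |e j| ^ p ≤ min (e j) (e j ^ p) * (1 + (S / a) ^ (p - 1)) := by
    intro j hj
    have hSa : 0 ≤ (S / a) ^ (p - 1) := by positivity
    rw [abs_of_nonneg (he j)]
    rcases le_total (e j) 1 with h | h
    · have : e j ^ p ≤ e j := by
        simpa using Real.rpow_le_rpow_of_exponent_ge' (he j) h zero_le_one hp.le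
      rw [min_eq_right this]
      nlinarith [hr j]
    · have h2 : e j ≤ e j ^ p := by simpa using Real.rpow_le_rpow_of_exponent_le h hp.le
      rw [min_eq_left h2]
      have h3 : e j ^ p = e j * e j ^ (p - 1) := by
        rw [← Real.rpow_one_add' (he j) (by linarith)]
        ring_nf
      rw [h3]
      refine mul_le_mul_of_nonneg_left ?_ (he j)
      have := Real.rpow_le_rpow (he j) (hD j hj) (by linarith : 0 ≤ p - 1)
      linarith
  have htail : (1 / (n : ℝ)) * ∑ i ∈ Finset.univ.filter (fun i : Fin n => l ≤ (i : ℕ)), |e i| ^ p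
      ≤ T * (1 + (S / a) ^ (p - 1)) := by
    rw [hT, truncAvg, mul_assoc, Finset.sum_mul]
    refine mul_le_mul_of_nonneg_left ?_ (by positivity)
    calc _ ≤ ∑ i ∈ Finset.univ.filter (fun i : Fin n => l ≤ (i : ℕ)), min (e i) (e i ^ p) * (1 + (S / a) ^ (p - 1)) :=
          Finset.sum_le_sum fun i hi => hbound i (Finset.mem_filter.1 hi).2
      _ ≤ _ := Finset.sum_le_sum_of_subset_of_nonneg (Finset.filter_subset _ _)
          fun j _ _ => mul_nonneg (hg0 j) (by positivity)
  set R := T + a with hR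
  have hR0 : 0 < R := by positivity
  have hfin : a ^ (1 - 1 / p) * ((1 / (n : ℝ)) * ∑ i ∈ Finset.univ.filter (fun i : Fin n => l ≤ (i : ℕ)), |e i| ^ p) ^ (1 / p)
      ≤ 2 * R := by
    have e1 : a ^ (1 - 1 / p) = (a ^ (p - 1)) ^ (1 / p) := by
      rw [← Real.rpow_mul ha0.le]
      congr 1
      field_simp
    rw [e1, ← Real.mul_rpow (by positivity) (by positivity)]
    have h2 : a ^ (p - 1) * ((1 / (n : ℝ)) * ∑ i ∈ Finset.univ.filter (fun i : Fin n => l ≤ (i : ℕ)), |e i| ^ p)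
        ≤ (2 * R) ^ p := by
      calc _ ≤ a ^ (p - 1) * (T * (1 + (S / a) ^ (p - 1))) :=
            mul_le_mul_of_nonneg_left htail (by positivity)
        _ = T * a ^ (p - 1) + T * S ^ (p - 1) := by
            rw [Real.div_rpow hS0 ha0.le]
            have : a ^ (p - 1) ≠ 0 := by positivity
            field_simp
        _ ≤ R * R ^ (p - 1) + R * R ^ (p - 1) := by
            have h1 : a ^ (p - 1) ≤ R ^ (p - 1) :=
              Real.rpow_le_rpow ha0.le (by linarith) (by linarith)
            have h2 : S ^ (p - 1) ≤ R ^ (p - 1) :=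
              Real.rpow_le_rpow hS0 hhead (by linarith)
            have h3 : T ≤ R := by linarith
            gcongr
        _ = 2 * R ^ p := by
            rw [← Real.rpow_one_add' hR0.le (by linarith)]
            ring_nf
        _ ≤ 2 ^ p * R ^ p := by
            have : (2 : ℝ) ≤ 2 ^ p := by
              simpa using Real.rpow_le_rpow_of_exponent_le one_le_two hp.le
            gcongr
        _ = _ := (Real.mul_rpow zero_le_two hR0.le).symm
    calc _ ≤ ((2 * R) ^ p) ^ (1 / p) := Real.rpow_le_rpow (by positivity) h2 (by positivity)
      _ = 2 * R := by
          rw [← Real.rpow_mul (by positivity), mul_one_div_cancel hp0.ne', Real.rpow_one]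
  unfold headTail
  linarith

end headTail

/-! ### The Orlicz norm as an average -/

namespace IsOrliczFunctionOf

variable {n : ℕ} {p A B : ℝ} {d : Fin n → ℝ} {M : ℝ → ℝ} (h : IsOrliczFunctionOf p A B d M)

include h

/-- Young's inequality for `u` and the inverse conjugate at `m / n`. With the factor `A / 2` the
product is at least twice the truncated average `T`, and one copy of `T` absorbs `m / n ≤ T + 1 /
n`. -/
lemma truncAvg_le (hn : 0 < n) (hp : 1 < p) (hA : 0 < A) (hd : ∀ j, 0 ≤ d j) {u : ℝ}
    (hu : 0 ≤ u) : truncAvg p (fun j => A / 2 * u * d j) ≤ M u + 1 / n := by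
  have hv : 0 ≤ A / 2 * u := by positivity
  obtain ⟨m, hm1, hmn, hm, hle⟩ := exists_truncAvg_le_headTail (p := p) hn hp
    (e := fun j => A / 2 * u * d j) fun j => mul_nonneg hv (hd j)
  rw [← mul_headTail hp d hv] at hle
  have h1 := h.lower m hm1 hmn
  have h2 := h.isOrlicz.conj_invFun (s := (m : ℝ) / n) (by positivity)
  have h3 := h.isOrlicz.mul_sub_le_conj (orliczInv (orliczConj M) ((m : ℝ) / n)) hu
  rw [h2.2] at h3
  have h4 := mul_le_mul_of_nonneg_right h1 hu
  nlinarith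

/-- With `t = u / (3 B)`, choose `y` with `M t = y t - s`, where `s` is the conjugate at `y`.
Rounding `s` up to `l / n` bounds `y t` by a third of the `headTail` of `u d` at `l`, hence by the
truncated average plus `l / n`; subtracting `s` leaves the error `1 / n`. -/
lemma map_le_truncAvg (hn : 0 < n) (hp : 1 < p) (hB : 0 < B) (hd : ∀ j, 0 ≤ d j)
    (hanti : Antitone d) {u : ℝ} (hu : 0 ≤ u) (hT : truncAvg p (fun j => u * d j) ≤ 1 / 4) :
    M (u / (3 * B)) ≤ truncAvg p (fun j => u * d j) + 1 / n := by
  have hM := h.isOrlicz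
  have hn' : (0 : ℝ) < n := by exact_mod_cast hn
  have he : ∀ j, 0 ≤ u * d j := fun j => mul_nonneg hu (hd j)
  set t := u / (3 * B) with ht
  have ht0 : 0 ≤ t := by positivity
  have htB : t * B = u / 3 := by rw [ht]; field_simp
  have hinv : ∀ l : ℕ, 1 ≤ l → l ≤ n → t * orliczInv (orliczConj M) ((l : ℝ) / n)
      ≤ headTail p (fun j => u * d j) l / 3 := by
    intro l h1 h2
    have h3 := mul_le_mul_of_nonneg_left (h.upper l h1 h2) ht0
    rw [← mul_assoc, htB] at h3
    rw [← mul_headTail hp d hu]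
    linarith
  obtain ⟨y, hy0, hy⟩ := hM.exists_conj_eq ht0
  have hMt := hM.nonneg ht0
  set s := orliczConj M y with hs
  have hs0 : 0 ≤ s := hM.conj_nonneg y
  -- Rounding must give `l ≤ n`. The bound 1/4 on the truncated average makes `t * y₁ < 1`, where
  -- the conjugate is 1 at `y₁`; if `y > y₁`, convexity would give `1 ≤ (y₁ / y) * s ≤ t * y₁`.
  have hs1 : s ≤ 1 := by
    have h1 := hinv n hn le_rfl
    have h2 := headTail_self_le hn hp he
    rw [div_self hn'.ne'] at h1
    obtain ⟨h3, h4⟩ := hM.conj_invFun zero_le_one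
    set y₁ := orliczInv (orliczConj M) 1
    rcases le_or_gt y y₁ with hle | hlt
    · exact (hM.conj_mono hle).trans h4.le
    · exfalso
      have hypos : 0 < y := h3.trans_lt hlt
      have h5 := hM.conj_mul_le (c := y₁ / y) (y := y) (div_nonneg h3 hypos.le)
        ((div_le_one hypos).2 hlt.le)
      rw [div_mul_cancel₀ _ hypos.ne', h4] at h5
      have h6 : y₁ / y * s ≤ y₁ / y * (y * t) :=
        mul_le_mul_of_nonneg_left (by linarith) (div_nonneg h3 hypos.le)
      have h7 : y₁ / y * (y * t) = t * y₁ := by field_simp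
      linarith
  have hns : 0 ≤ (n : ℝ) * s := by positivity
  -- The maximum covers `s = 0`, since the relation to `d` only starts at `l = 1`.
  set l := max 1 ⌈(n : ℝ) * s⌉₊ with hl
  have hl1 : 1 ≤ l := le_max_left _ _
  have hln : l ≤ n := by
    refine max_le hn (Nat.ceil_le.2 ?_)
    nlinarith
  have hsl : s ≤ (l : ℝ) / n := by
    rw [le_div_iff₀ hn', mul_comm]
    exact (Nat.le_ceil _).trans (by exact_mod_cast le_max_right _ _)
  have hls : (l : ℝ) / n - 1 / n ≤ s := by
    rw [← sub_div, div_le_iff₀ hn']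
    rcases max_choice 1 ⌈(n : ℝ) * s⌉₊ with h1 | h1
    · rw [hl, h1]
      simpa using by linarith
    · rw [hl, h1]
      have := Nat.ceil_lt_add_one hns
      linarith
  have hl' : (0 : ℝ) < l := by exact_mod_cast hl1
  have hyl := hM.le_invFun (s := (l : ℝ) / n) (by positivity) hsl
  have h1 := hinv l hl1 hln
  have h2 := headTail_le hp he (fun i j hij => mul_le_mul_of_nonneg_left (hanti hij) hu) hl1 hln
  have h3 := mul_le_mul_of_nonneg_left hyl ht0
  linarith

lemma permAvg_ellNorm_le (hn : 0 < n) (hp : 1 < p) (hA : 0 < A) (hd : ∀ j, 0 ≤ d j)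
    {w : Fin n → ℝ} (hw : ∀ k, 0 ≤ w k) {ρ : ℝ} (hρ : 0 < ρ) (hsum : ∑ k, M (w k / ρ) ≤ 1) :
    permAvg (fun σ => ellNorm p fun k => w k * d (σ k)) ≤ 6 / A * ρ := by
  have hn' : (0 : ℝ) < n := by exact_mod_cast hn
  set c := 2 / A * ρ with hc
  have hc0 : 0 < c := by positivity
  have hb : ∀ k j, 0 ≤ A / 2 * (w k / ρ) * d j := fun k j => by
    have := hw k; have := hd j; positivity
  have h1 := _root_.permAvg_ellNorm_le (q := p) hp.le
    (b := fun k j => A / 2 * (w k / ρ) * d j) hb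
  have h2 : ∑ k, (1 / (n : ℝ)) * ∑ j, min (A / 2 * (w k / ρ) * d j)
      ((A / 2 * (w k / ρ) * d j) ^ p) ≤ 2 := by
    calc _ ≤ ∑ k, (M (w k / ρ) + 1 / n) :=
          Finset.sum_le_sum fun k _ => h.truncAvg_le hn hp hA hd (div_nonneg (hw k) hρ.le)
      _ = ∑ k, M (w k / ρ) + 1 := by
          rw [Finset.sum_add_distrib]
          simp [hn'.ne']
      _ ≤ 2 := by linarith
  have h3 : permAvg (fun σ => ellNorm p fun k => w k * d (σ k))
      = c * permAvg (fun σ => ellNorm p fun k => A / 2 * (w k / ρ) * d (σ k)) := by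
    rw [← permAvg_const_mul]
    congr 1
    funext σ
    rw [← ellNorm_const_mul hp.le hc0.le fun k => hb k _]
    congr 1
    funext k
    rw [hc]
    field_simp
  rw [h3]
  calc _ ≤ c * 3 := mul_le_mul_of_nonneg_left (by linarith) hc0.le
    _ = _ := by rw [hc]; ring

lemma sum_map_div_le_one (hn : 0 < n) (hp : 1 < p) (hB : 0 < B) (hd : ∀ j, 0 ≤ d j)
    (hanti : Antitone d) {w : Fin n → ℝ} (hw : ∀ k, 0 ≤ w k) {ρ : ℝ} (hρ : 0 < ρ)
    (hE : 96 * B * permAvg (fun σ => ellNorm p fun k => w k * d (σ k)) < ρ) :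
    ∑ k, M (w k / ρ) ≤ 1 := by
  have hn' : (0 : ℝ) < n := by exact_mod_cast hn
  -- Here `6 B = 2 * 3 B`: `3 B` comes from `map_le_truncAvg`, and the 2 halves the total `1/4 + 1`
  -- by convexity. The threshold 1/16 then gives `96 = 16 * 6`.
  set c := 6 * B / ρ with hc
  have hc0 : 0 < c := by positivity
  have hu : ∀ k, 0 ≤ c * w k := fun k => mul_nonneg hc0.le (hw k)
  have h1 : permAvg (fun σ => ellNorm p fun k => c * w k * d (σ k)) < 1 / 16 := by
    have e : permAvg (fun σ => ellNorm p fun k => c * w k * d (σ k))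
        = c * permAvg (fun σ => ellNorm p fun k => w k * d (σ k)) := by
      rw [← permAvg_const_mul]
      congr 1
      funext σ
      rw [← ellNorm_const_mul hp.le hc0.le fun k => mul_nonneg (hw k) (hd _)]
      simp_rw [mul_assoc]
    rw [e, hc, div_mul_eq_mul_div, div_lt_iff₀ hρ]
    linarith
  have h2 := sum_min_le_of_permAvg_ellNorm_lt (q := p) hp.le (b := fun k j => c * w k * d j)
    (fun k j => mul_nonneg (hu k) (hd j)) h1
  have hT0 : ∀ k, 0 ≤ truncAvg p (fun j => c * w k * d j) := fun k =>
    truncAvg_nonneg fun j => mul_nonneg (hu k) (hd j)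
  have h2' : ∑ k, truncAvg p (fun j => c * w k * d j) ≤ 1 / 4 := h2
  have h3 : ∀ k, M (w k / ρ) ≤ 1 / 2 * (truncAvg p (fun j => c * w k * d j) + 1 / n) := by
    intro k
    have hk : truncAvg p (fun j => c * w k * d j) ≤ 1 / 4 :=
      (Finset.single_le_sum (f := fun k => truncAvg p (fun j => c * w k * d j))
        (fun k _ => hT0 k) (Finset.mem_univ k)).trans h2'
    have h4 := h.map_le_truncAvg hn hp hB hd hanti (hu k) hk
    have h5 := h.isOrlicz.map_mul_le (c := 1 / 2) (t := c * w k / (3 * B)) (by norm_num)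
      (by norm_num) (div_nonneg (hu k) (by positivity))
    have e : 1 / 2 * (c * w k / (3 * B)) = w k / ρ := by
      rw [hc]; field_simp; ring
    rw [e] at h5
    linarith
  calc _ ≤ ∑ k, 1 / 2 * (truncAvg p (fun j => c * w k * d j) + 1 / n) :=
        Finset.sum_le_sum fun k _ => h3 k
    _ = 1 / 2 * (∑ k, truncAvg p (fun j => c * w k * d j) + 1) := by
        rw [← Finset.mul_sum, Finset.sum_add_distrib]
        simp [hn'.ne']
    _ ≤ 1 := by linarith

end IsOrliczFunctionOf

/-! ### Averages against the weights `(n / i)^{1/p}` -/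

/-- One step of comparing a sum of `x ^ (-α)` with its integral, by Bernoulli's inequality. -/
lemma one_sub_mul_rpow_neg_le {α x : ℝ} (h0 : 0 < α) (h1 : α < 1) (hx : 1 ≤ x) :
    (1 - α) * x ^ (-α) ≤ x ^ (1 - α) - (x - 1) ^ (1 - α) := by
  have hx0 : 0 < x := by linarith
  have hb := _root_.rpow_one_add_le_one_add_mul_self (s := -(1 / x))
    (neg_le_neg ((div_le_one hx0).2 hx)) (p := 1 - α) (by linarith) (by linarith)
  have e1 : (x - 1) ^ (1 - α) = x ^ (1 - α) * (1 + -(1 / x)) ^ (1 - α) := by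
    rw [← Real.mul_rpow hx0.le (by
      have := (div_le_one hx0).2 hx
      linarith)]
    congr 1
    field_simp
    ring
  have e2 : x ^ (1 - α) * x⁻¹ = x ^ (-α) := by
    rw [← Real.rpow_neg_one, ← Real.rpow_add hx0]
    ring_nf
  have hpos : 0 < x ^ (1 - α) := by positivity
  have := mul_le_mul_of_nonneg_left hb hpos.le
  rw [e1, ← e2]
  rw [one_div] at this ⊢
  linarith

lemma sub_one_mul_rpow_neg_le {β x : ℝ} (h1 : 1 < β) (h2 : β < 2) (hx : 1 < x) :
    (β - 1) * x ^ (-β) ≤ (x - 1) ^ (1 - β) - x ^ (1 - β) := by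
  have hx0 : 0 < x := by linarith
  have hx1 : 1 / x < 1 := (div_lt_one hx0).2 hx
  have hxp : 0 < 1 / x := by positivity
  set y := 1 + -(1 / x) with hy
  have hy0 : 0 < y := by linarith
  have hb := _root_.rpow_one_add_le_one_add_mul_self (s := -(1 / x)) (by linarith)
    (p := β - 1) (by linarith) (by linarith)
  rw [← hy] at hb
  have e1 : (x - 1) ^ (1 - β) = x ^ (1 - β) * y ^ (1 - β) := by
    rw [← Real.mul_rpow hx0.le hy0.le]
    congr 1
    rw [hy]
    field_simp
    ring
  have e2 : x ^ (1 - β) * (1 / x) = x ^ (-β) := by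
    rw [one_div, ← Real.rpow_neg_one, ← Real.rpow_add hx0]
    ring_nf
  have e3 : y ^ (1 - β) * y ^ (β - 1) = 1 := by
    rw [← Real.rpow_add hy0]
    simp
  have hpos : 0 < x ^ (1 - β) := by positivity
  have hq : 0 < y ^ (β - 1) := by positivity
  have hr : 0 < y ^ (1 - β) := by positivity
  have h3 : 1 + (β - 1) * (1 / x) ≤ y ^ (1 - β) := by
    have h4 : (1 + (β - 1) * (1 / x)) * y ^ (β - 1) ≤ 1 := by
      have hu : 0 < (β - 1) * (1 / x) := mul_pos (by linarith) hxp
      calc _ ≤ (1 + (β - 1) * (1 / x)) * (1 + (β - 1) * -(1 / x)) :=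
            mul_le_mul_of_nonneg_left hb (by linarith)
        _ ≤ 1 := by nlinarith
    exact le_of_mul_le_mul_right (h4.trans_eq e3.symm) hq
  have := mul_le_mul_of_nonneg_left h3 hpos.le
  rw [e1, ← e2]
  linarith

/-- Compare with integrals: up to index `N` the power `α < 1` contributes about `N / (1 - α)`, and
beyond `N` the power `β > 1` contributes about `N / (β - 1)`. The middle 1 in the constant pays for
the first index past `N`. -/
lemma sum_min_rpow_div_le {α β N : ℝ} (hα : 0 < α) (hα1 : α < 1) (hβ : 1 < β) (hβ2 : β < 2)
    (hN : 0 ≤ N) (m : ℕ) :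
    ∑ j ∈ Finset.range m, min ((N / ((j : ℝ) + 1)) ^ α) ((N / ((j : ℝ) + 1)) ^ β)
      ≤ (1 / (1 - α) + 1 + 1 / (β - 1)) * N := by
  rcases hN.eq_or_lt with rfl | hN0
  · simp [Real.zero_rpow hα.ne', Real.zero_rpow (by linarith : β ≠ 0)]
  set K := 1 / (1 - α) + 1 + 1 / (β - 1) with hK
  have hα' : 0 < 1 - α := by linarith
  have hβ' : 0 < β - 1 := by linarith
  have hbal : ∀ x : ℝ, 0 < x → x ≤ N → N ^ α * x ^ (1 - α) ≤ N := by
    intro x hx hxN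
    calc N ^ α * x ^ (1 - α) ≤ N ^ α * N ^ (1 - α) := by
          gcongr
      _ = N := by rw [← Real.rpow_add hN0]; simp
  have hneg : ∀ x : ℝ, 0 < x → N ^ β * x ^ (-β) = (N / x) ^ β := by
    intro x hx
    rw [Real.div_rpow hN hx.le, Real.rpow_neg hx.le, div_eq_mul_inv]
  have hneg' : ∀ x : ℝ, 0 < x → N ^ α * x ^ (-α) = (N / x) ^ α := by
    intro x hx
    rw [Real.div_rpow hN hx.le, Real.rpow_neg hx.le, div_eq_mul_inv]
  -- The induction carries the antiderivative at `m`, so that past `N` the differences telescope.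
  have main : ∀ m : ℕ, ((m : ℝ) ≤ N →
      ∑ j ∈ Finset.range m, min ((N / ((j : ℝ) + 1)) ^ α) ((N / ((j : ℝ) + 1)) ^ β)
        ≤ N ^ α * (m : ℝ) ^ (1 - α) / (1 - α)) ∧ (N < m →
      ∑ j ∈ Finset.range m, min ((N / ((j : ℝ) + 1)) ^ α) ((N / ((j : ℝ) + 1)) ^ β)
        ≤ K * N - N ^ β * (m : ℝ) ^ (1 - β) / (β - 1)) := by
    intro m
    induction m with
    | zero =>
      refine ⟨fun _ => ?_, fun h => ?_⟩
      · simp [Real.zero_rpow hα'.ne']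
      · simp at h; linarith
    | succ m ih =>
      have hx0 : (0 : ℝ) < (m : ℝ) + 1 := by positivity
      refine ⟨fun h => ?_, fun h => ?_⟩
      · push_cast at h ⊢
        rw [Finset.sum_range_succ]
        have h1 := ih.1 (by linarith)
        have h2 := one_sub_mul_rpow_neg_le hα hα1 (x := (m : ℝ) + 1) (by linarith [m.cast_nonneg (α := ℝ)])
        rw [add_sub_cancel_right] at h2
        have h3 := min_le_left ((N / ((m : ℝ) + 1)) ^ α) ((N / ((m : ℝ) + 1)) ^ β)
        rw [← hneg' _ hx0] at h3
        rw [le_div_iff₀ hα'] at h1 ⊢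
        have h4 := mul_le_mul_of_nonneg_left h2 (Real.rpow_nonneg hN α)
        rw [← hneg' _ hx0]
        have h5 := mul_le_mul_of_nonneg_right h3 hα'.le
        linarith
      · push_cast at h ⊢
        rw [Finset.sum_range_succ]
        have h3 := min_le_right ((N / ((m : ℝ) + 1)) ^ α) ((N / ((m : ℝ) + 1)) ^ β)
        rcases le_or_gt (m : ℝ) N with hm | hm
        · have h1 := ih.1 hm
          have h1' : N ^ α * (m : ℝ) ^ (1 - α) / (1 - α) ≤ 1 / (1 - α) * N := by
            rw [one_div_mul_eq_div]
            refine div_le_div_of_nonneg_right ?_ hα'.le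
            rcases (m.cast_nonneg (α := ℝ)).eq_or_lt with h0 | h0
            · rw [← h0, Real.zero_rpow hα'.ne', mul_zero]; exact hN
            · exact hbal _ h0 hm
          have hlt : N / ((m : ℝ) + 1) ≤ 1 := (div_le_one hx0).2 h.le
          have hd0 : 0 ≤ N / ((m : ℝ) + 1) := by positivity
          have h2 : (N / ((m : ℝ) + 1)) ^ β ≤ N := by
            calc _ ≤ N / ((m : ℝ) + 1) := by
                  simpa using Real.rpow_le_rpow_of_exponent_ge' hd0 hlt zero_le_one hβ.le
              _ ≤ N := div_le_self hN (by linarith [m.cast_nonneg (α := ℝ)])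
          have h4 : N ^ β * ((m : ℝ) + 1) ^ (1 - β) ≤ N := by
            have e : N ^ β * ((m : ℝ) + 1) ^ (1 - β) = N * (N / ((m : ℝ) + 1)) ^ (β - 1) := by
              rw [Real.div_rpow hN hx0.le, ← neg_sub β 1, Real.rpow_neg hx0.le,
                div_eq_mul_inv, ← mul_assoc, ← Real.rpow_one_add' hN (by linarith)]
              ring_nf
            rw [e]
            exact mul_le_of_le_one_right hN (Real.rpow_le_one hd0 hlt hβ'.le)
          have h5 := div_le_div_of_nonneg_right h4 hβ'.le
          have e : K * N = 1 / (1 - α) * N + N + N / (β - 1) := by rw [hK]; ring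
          rw [e]
          linarith
        · have h1 := ih.2 hm
          have h2 := sub_one_mul_rpow_neg_le hβ hβ2 (x := (m : ℝ) + 1) (by linarith)
          rw [add_sub_cancel_right] at h2
          have h4 := mul_le_mul_of_nonneg_left h2 (Real.rpow_nonneg hN β)
          have h5 : N ^ β * ((m : ℝ) + 1) ^ (-β)
              ≤ N ^ β * (m : ℝ) ^ (1 - β) / (β - 1)
                - N ^ β * ((m : ℝ) + 1) ^ (1 - β) / (β - 1) := by
            rw [← sub_div, le_div_iff₀ hβ']
            linarith
          rw [← hneg _ hx0] at h3 ⊢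
          linarith
  rcases le_or_gt (m : ℝ) N with hm | hm
  · refine ((main m).1 hm).trans ?_
    have h1 : N ^ α * (m : ℝ) ^ (1 - α) / (1 - α) ≤ 1 / (1 - α) * N := by
      rw [one_div_mul_eq_div]
      refine div_le_div_of_nonneg_right ?_ hα'.le
      rcases (m.cast_nonneg (α := ℝ)).eq_or_lt with h0 | h0
      · rw [← h0, Real.zero_rpow hα'.ne', mul_zero]; exact hN
      · exact hbal _ h0 hm
    have h2 : 0 ≤ 1 / (β - 1) * N := by positivity
    rw [hK]
    linarith
  · refine ((main m).2 hm).trans ?_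
    have : 0 ≤ N ^ β * (m : ℝ) ^ (1 - β) / (β - 1) := by positivity
    linarith

/-- The constant in `sum_min_rpow_div_le` for the exponents `1 / p` and `2 / p`. -/
def zConst (p : ℝ) : ℝ := 1 / (1 - 1 / p) + 1 + 1 / (2 / p - 1)

section zVec

variable {n : ℕ} {p : ℝ}

lemma zConst_nonneg (hp1 : 1 < p) (hp2 : p < 2) : 0 ≤ zConst p := by
  have hp0 : 0 < p := by linarith
  have h1 : 1 / p < 1 := (div_lt_one hp0).2 hp1
  have h2 : 1 < 2 / p := (one_lt_div hp0).2 hp2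
  have h3 : 0 < 1 - 1 / p := by linarith
  have h4 : 0 < 2 / p - 1 := by linarith
  unfold zConst
  positivity

lemma zVec_nonneg (j : Fin n) : 0 ≤ zVec n p j := by unfold zVec; positivity

lemma mul_zVec (hp : 0 < p) {v : ℝ} (hv : 0 ≤ v) (j : Fin n) :
    v * zVec n p j = ((n * v ^ p) / (((j : ℕ) : ℝ) + 1)) ^ (1 / p) := by
  have e : v = (v ^ p) ^ (1 / p) := by
    rw [← Real.rpow_mul hv, mul_one_div_cancel hp.ne', Real.rpow_one]
  unfold zVec
  conv_lhs => rw [e]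
  rw [← Real.mul_rpow (by positivity) (by positivity)]
  congr 1
  ring

/-- The entries `v z_i` equal `(n v^p / i) ^ (1/p)`, so the sum lemma applies with exponents `1/p <
1 < 2/p`; this needs `1 < p < 2`. -/
lemma truncAvg_zVec_le (hn : 0 < n) (hp1 : 1 < p) (hp2 : p < 2) {v : ℝ} (hv : 0 ≤ v) :
    truncAvg 2 (fun j => v * zVec n p j) ≤ zConst p * v ^ p := by
  have hp0 : 0 < p := by linarith
  have hn' : (0 : ℝ) < n := by exact_mod_cast hn
  have h1 : 1 / p < 1 := (div_lt_one hp0).2 hp1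
  have h2 : 1 < 2 / p := (one_lt_div hp0).2 hp2
  have h3 : 2 / p < 2 := div_lt_self two_pos hp1
  have h := sum_min_rpow_div_le (α := 1 / p) (β := 2 / p) (N := n * v ^ p) (by positivity) h1 h2 h3
    (by positivity) n
  rw [← Fin.sum_univ_eq_sum_range (fun j : ℕ => min ((n * v ^ p / ((j : ℝ) + 1)) ^ (1 / p))
    ((n * v ^ p / ((j : ℝ) + 1)) ^ (2 / p)))] at h
  have e : ∀ j : Fin n, min (v * zVec n p j) ((v * zVec n p j) ^ (2 : ℝ))
      = min ((n * v ^ p / (((j : ℕ) : ℝ) + 1)) ^ (1 / p))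
        ((n * v ^ p / (((j : ℕ) : ℝ) + 1)) ^ (2 / p)) := by
    intro j
    rw [mul_zVec hp0 hv, ← Real.rpow_mul (by positivity)]
    ring_nf
  unfold truncAvg
  simp_rw [e]
  calc _ ≤ 1 / (n : ℝ) * (zConst p * (n * v ^ p)) := mul_le_mul_of_nonneg_left h (by positivity)
    _ = _ := by field_simp

/-- Each index `i ≤ n v^p` has `v z_i ≥ 1` and contributes at least `1 / n`; taking the floor costs
`1 / n`. The smallness hypothesis excludes `v^p ≥ 1`, where all `n` indices would count. -/
lemma rpow_le_truncAvg_zVec (hn : 0 < n) (hp1 : 1 < p) {v : ℝ} (hv : 0 ≤ v)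
    (hT : truncAvg 2 (fun j => v * zVec n p j) ≤ 1 / 4) :
    v ^ p ≤ truncAvg 2 (fun j => v * zVec n p j) + 1 / n := by
  have hp0 : 0 < p := by linarith
  have hn' : (0 : ℝ) < n := by exact_mod_cast hn
  have hb0 : ∀ j, 0 ≤ v * zVec n p j := fun j => mul_nonneg hv (zVec_nonneg j)
  have hg0 : ∀ j, 0 ≤ min (v * zVec n p j) ((v * zVec n p j) ^ (2 : ℝ)) := fun j =>
    le_min (hb0 j) (Real.rpow_nonneg (hb0 j) _)
  have hmin : ∀ j : Fin n, ((j : ℕ) : ℝ) + 1 ≤ n * v ^ p →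
      1 ≤ min (v * zVec n p j) ((v * zVec n p j) ^ (2 : ℝ)) := by
    intro j hj
    have h1 : 1 ≤ v * zVec n p j := by
      rw [mul_zVec hp0 hv]
      exact Real.one_le_rpow ((one_le_div (by positivity)).2 hj) (by positivity)
    exact le_min h1 (Real.one_le_rpow h1 zero_le_two)
  have hcount : ∀ m : ℕ, m ≤ n → (m : ℝ) ≤ n * v ^ p →
      (m : ℝ) / n ≤ truncAvg 2 (fun j => v * zVec n p j) := by
    intro m hmn hm
    rw [truncAvg, ← one_div_mul_eq_div]
    refine mul_le_mul_of_nonneg_left ?_ (by positivity)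
    calc (m : ℝ) = ∑ i ∈ Finset.univ.filter (fun i : Fin n => (i : ℕ) < m), (1 : ℝ) := by
          simp only [Finset.sum_const, card_filter_lt hmn, nsmul_eq_mul, mul_one]
      _ ≤ ∑ i ∈ Finset.univ.filter (fun i : Fin n => (i : ℕ) < m),
          min (v * zVec n p i) ((v * zVec n p i) ^ (2 : ℝ)) := by
          refine Finset.sum_le_sum fun i hi => hmin i ?_
          have h1 : (i : ℕ) + 1 ≤ m := (Finset.mem_filter.1 hi).2
          have h2 : ((i : ℕ) : ℝ) + 1 ≤ m := by exact_mod_cast h1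
          linarith
      _ ≤ _ := Finset.sum_le_sum_of_subset_of_nonneg (Finset.filter_subset _ _)
          fun j _ _ => hg0 j
  have hv1 : v ^ p < 1 := by
    by_contra! hge
    have h1 := hcount n le_rfl (le_mul_of_one_le_right hn'.le hge)
    rw [div_self hn'.ne'] at h1
    linarith
  have hnv : 0 ≤ (n : ℝ) * v ^ p := by positivity
  have h1 := hcount ⌊(n : ℝ) * v ^ p⌋₊
    (by
      rw [← Nat.floor_natCast (R := ℝ) n]
      refine Nat.floor_le_floor ?_
      simpa using mul_le_of_le_one_right hn'.le hv1.le) (Nat.floor_le hnv)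
  have h2 := Nat.lt_floor_add_one ((n : ℝ) * v ^ p)
  have h3 : v ^ p ≤ ((⌊(n : ℝ) * v ^ p⌋₊ : ℝ) + 1) / n := by
    rw [le_div_iff₀ hn']
    linarith
  rw [add_div] at h3
  linarith

lemma permAvg_ellNorm_two_zVec_eq {v : Fin n → ℝ} (hv : ∀ k, 0 ≤ v k) {ρ : ℝ} (hρ : 0 < ρ) :
    permAvg (fun η => ellNorm 2 fun k => v k * zVec n p (η k))
      = ρ * permAvg (fun η => ellNorm 2 fun k => v k / ρ * zVec n p (η k)) := by
  rw [← permAvg_const_mul]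
  congr 1
  funext η
  rw [← ellNorm_const_mul one_le_two hρ.le fun k =>
    mul_nonneg (div_nonneg (hv k) hρ.le) (zVec_nonneg _)]
  congr 1
  funext k
  field_simp

lemma ellNorm_div (hp : 1 ≤ p) {v : Fin n → ℝ} (hv : ∀ k, 0 ≤ v k) {ρ : ℝ} (hρ : 0 < ρ) :
    ellNorm p (fun k => v k / ρ) = ellNorm p v / ρ := by
  have := ellNorm_const_mul hp (inv_nonneg.2 hρ.le) hv
  simpa [div_eq_inv_mul] using this

lemma permAvg_ellNorm_two_zVec_le (hn : 0 < n) (hp1 : 1 < p) (hp2 : p < 2) {v : Fin n → ℝ}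
    (hv : ∀ k, 0 ≤ v k) :
    permAvg (fun η => ellNorm 2 fun k => v k * zVec n p (η k))
      ≤ (1 + zConst p) * ellNorm p v := by
  have hK : 0 < 1 + zConst p := by linarith [zConst_nonneg hp1 hp2]
  rw [← div_le_iff₀' hK]
  refine le_of_forall_gt_imp_ge_of_dense fun ρ hlt => ?_
  have hρ : 0 < ρ := (ellNorm_nonneg hv).trans_lt hlt
  have hvρ : ∀ k, 0 ≤ v k / ρ := fun k => div_nonneg (hv k) hρ.le
  rw [div_le_iff₀' hK, permAvg_ellNorm_two_zVec_eq hv hρ, mul_comm _ ρ]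
  refine mul_le_mul_of_nonneg_left ?_ hρ.le
  refine (permAvg_ellNorm_le (q := 2) one_le_two (b := fun k j => v k / ρ * zVec n p j)
    fun k j => mul_nonneg (hvρ k) (zVec_nonneg j)).trans ?_
  gcongr
  calc _ ≤ ∑ k, zConst p * (v k / ρ) ^ p :=
        Finset.sum_le_sum fun k _ => truncAvg_zVec_le hn hp1 hp2 (hvρ k)
    _ = zConst p * ellNorm p (fun k => v k / ρ) ^ p := by
        rw [← Finset.mul_sum, ellNorm_rpow hp1.le hvρ]
    _ ≤ zConst p * 1 := by
        refine mul_le_mul_of_nonneg_left ?_ (zConst_nonneg hp1 hp2)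
        refine Real.rpow_le_one (ellNorm_nonneg hvρ) ?_ (by linarith)
        rw [ellNorm_div hp1.le hv hρ]
        exact (div_le_one hρ).2 hlt.le
    _ = _ := mul_one _

lemma ellNorm_le_permAvg_ellNorm_two_zVec (hn : 0 < n) (hp1 : 1 < p) {v : Fin n → ℝ}
    (hv : ∀ k, 0 ≤ v k) :
    ellNorm p v ≤ 32 * permAvg (fun η => ellNorm 2 fun k => v k * zVec n p (η k)) := by
  have hn' : (0 : ℝ) < n := by exact_mod_cast hn
  refine le_of_forall_gt_imp_ge_of_dense fun ρ' hlt => ?_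
  -- The constant is `32 = 2 * 16`: 16 from the threshold 1/16, and 2 because the rescaled `p`-th
  -- powers sum to at most 2.
  obtain ⟨ρ, rfl⟩ : ∃ ρ, ρ' = 2 * ρ := ⟨ρ' / 2, by ring⟩
  have hE0 : 0 ≤ permAvg (fun η => ellNorm 2 fun k => v k * zVec n p (η k)) :=
    permAvg_nonneg fun η => ellNorm_nonneg fun k => mul_nonneg (hv k) (zVec_nonneg _)
  have hρ : 0 < ρ := by linarith
  have hvρ : ∀ k, 0 ≤ v k / ρ := fun k => div_nonneg (hv k) hρ.le
  rw [permAvg_ellNorm_two_zVec_eq hv hρ] at hlt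
  have h1 : permAvg (fun η => ellNorm 2 fun k => v k / ρ * zVec n p (η k)) < 1 / 16 := by
    by_contra! hge
    have := mul_le_mul_of_nonneg_left hge hρ.le
    linarith
  have h2 := sum_min_le_of_permAvg_ellNorm_lt (q := 2) one_le_two
    (b := fun k j => v k / ρ * zVec n p j) (fun k j => mul_nonneg (hvρ k) (zVec_nonneg j)) h1
  have h2' : ∑ k, truncAvg 2 (fun j => v k / ρ * zVec n p j) ≤ 1 / 4 := h2
  have h3 : ∑ k, (v k / ρ) ^ p ≤ 2 := by
    calc _ ≤ ∑ k, (truncAvg 2 (fun j => v k / ρ * zVec n p j) + 1 / (n : ℝ)) := by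
          refine Finset.sum_le_sum fun k _ => rpow_le_truncAvg_zVec hn hp1 (hvρ k) ?_
          exact (Finset.single_le_sum
            (f := fun k => truncAvg 2 (fun j => v k / ρ * zVec n p j))
            (fun k _ => truncAvg_nonneg fun j => mul_nonneg (hvρ k) (zVec_nonneg j))
            (Finset.mem_univ k)).trans h2'
      _ = ∑ k, truncAvg 2 (fun j => v k / ρ * zVec n p j) + 1 := by
          rw [Finset.sum_add_distrib]
          simp [hn'.ne']
      _ ≤ 2 := by linarith
  have h4 : ellNorm p (fun k => v k / ρ) ≤ 2 := by
    by_contra! hgt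
    have h5 := Real.rpow_le_rpow_of_exponent_le (by linarith :
      1 ≤ ellNorm p (fun k => v k / ρ)) hp1.le
    rw [Real.rpow_one, ellNorm_rpow hp1.le hvρ] at h5
    linarith
  rw [ellNorm_div hp1.le hv hρ, div_le_iff₀ hρ] at h4
  exact h4

end zVec

/-! ### Random restrictions -/

/-- The indicator of the first `⌊n / (k + 1)⌋` coordinates. -/
def headIndicator {n : ℕ} (k j : Fin n) : ℝ := if (j : ℕ) < n / ((k : ℕ) + 1) then 1 else 0

section restriction

variable {n : ℕ} {p : ℝ} {x y : Fin n → ℝ}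

lemma headIndicator_nonneg (k j : Fin n) : 0 ≤ headIndicator k j := by
  unfold headIndicator; split_ifs <;> norm_num

lemma headIndicator_rpow (k j : Fin n) {q : ℝ} (hq : q ≠ 0) :
    headIndicator k j ^ q = headIndicator k j := by
  unfold headIndicator; split_ifs <;> simp [hq]

lemma cVec_eq (a : Fin n → ℝ) (k j : Fin n) : cVec a k j = a k * headIndicator k j := by
  unfold cVec headIndicator; split_ifs <;> simp

lemma sum_headIndicator (k : Fin n) :
    ∑ j, headIndicator k j = ((n / ((k : ℕ) + 1) : ℕ) : ℝ) := by
  unfold headIndicator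
  rw [Finset.sum_boole, card_filter_lt (Nat.div_le_self _ _)]

lemma avg_headIndicator_le (k : Fin n) :
    (1 / (n : ℝ)) * ∑ j, headIndicator k j ≤ 1 / (((k : ℕ) : ℝ) + 1) := by
  have hn : (0 : ℝ) < n := by exact_mod_cast k.pos
  rw [sum_headIndicator, one_div_mul_eq_div, div_le_div_iff₀ hn (by positivity)]
  have := Nat.div_mul_le_self n ((k : ℕ) + 1)
  rw [one_mul]
  exact_mod_cast this

/-- A positive integer `⌊n / (k + 1)⌋` loses at most a factor 2 against `n / (k + 1)`. -/
lemma half_le_avg_headIndicator (k : Fin n) :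
    1 / 2 ≤ (((k : ℕ) : ℝ) + 1) * ((1 / (n : ℝ)) * ∑ j, headIndicator k j) := by
  have hn : (0 : ℝ) < n := by exact_mod_cast k.pos
  have h1 : 1 ≤ n / ((k : ℕ) + 1) := Nat.div_pos k.2 (Nat.succ_pos _)
  have h2 : n < ((k : ℕ) + 1) * (n / ((k : ℕ) + 1)) + ((k : ℕ) + 1) := by
    have := Nat.lt_mul_div_succ n (Nat.succ_pos (k : ℕ))
    rw [Nat.succ_eq_add_one, mul_add, mul_one] at this
    exact this
  have h3 : n ≤ 2 * (((k : ℕ) + 1) * (n / ((k : ℕ) + 1))) := by nlinarith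
  have h4 : (n : ℝ) ≤ 2 * ((((k : ℕ) : ℝ) + 1) * ((n / ((k : ℕ) + 1) : ℕ) : ℝ)) := by
    exact_mod_cast h3
  rw [sum_headIndicator, one_div_mul_eq_div, ← mul_div_assoc, le_div_iff₀ hn]
  linarith

lemma card_filter_le (k : Fin n) :
    (Finset.univ.filter fun i : Fin n => i ≤ k).card = (k : ℕ) + 1 := by
  rw [← card_filter_lt (n := n) (l := (k : ℕ) + 1) k.2]
  refine congrArg Finset.card (Finset.filter_congr fun i _ => ?_)
  rw [Fin.le_def, Nat.lt_succ_iff]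

/-- The first `k + 1` coordinates are all at least `x k`, and each is selected with probability at
least `1 / (2 (k + 1))`. After division by `x k` the truncated sum is at least 1/2, which rules out
an average below 1/16. -/
lemma le_permAvg_ellNorm_headIndicator (hx : ∀ i, 0 ≤ x i) (hanti : Antitone x) (k : Fin n) :
    x k ≤ 16 * permAvg fun π => ellNorm 2 fun i => x i * headIndicator k (π i) := by
  by_contra! hlt
  have hE0 : 0 ≤ permAvg fun π => ellNorm 2 fun i => x i * headIndicator k (π i) :=
    permAvg_nonneg fun π => ellNorm_nonneg fun i => mul_nonneg (hx i) (headIndicator_nonneg _ _)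
  have hxk : 0 < x k := by linarith
  have hc : 0 ≤ (x k)⁻¹ := by positivity
  have hb : ∀ i j, 0 ≤ (x k)⁻¹ * (x i * headIndicator k j) := fun i j =>
    mul_nonneg hc (mul_nonneg (hx i) (headIndicator_nonneg _ _))
  have h1 : permAvg (fun π => ellNorm 2 fun i => (x k)⁻¹ * (x i * headIndicator k (π i)))
      < 1 / 16 := by
    have e : permAvg (fun π => ellNorm 2 fun i => (x k)⁻¹ * (x i * headIndicator k (π i)))
        = (x k)⁻¹ * permAvg fun π => ellNorm 2 fun i => x i * headIndicator k (π i) := by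
      rw [← permAvg_const_mul]
      congr 1
      funext π
      exact ellNorm_const_mul one_le_two hc fun i => mul_nonneg (hx i) (headIndicator_nonneg _ _)
    rw [e, inv_mul_lt_iff₀ hxk]
    linarith
  have h2 := sum_min_le_of_permAvg_ellNorm_lt one_le_two hb h1
  have h3 : ∀ i, i ≤ k → (1 / (n : ℝ)) * ∑ j, headIndicator k j
      ≤ truncAvg 2 fun j => (x k)⁻¹ * (x i * headIndicator k j) := by
    intro i hi
    refine mul_le_mul_of_nonneg_left (Finset.sum_le_sum fun j _ => ?_) (by positivity)
    have h4 : 1 ≤ (x k)⁻¹ * x i := by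
      rw [inv_mul_eq_div]
      exact (one_le_div hxk).2 (hanti hi)
    simp only
    rw [← mul_assoc, Real.mul_rpow (by linarith) (headIndicator_nonneg _ _),
      headIndicator_rpow _ _ two_ne_zero, le_min_iff]
    exact ⟨le_mul_of_one_le_left (headIndicator_nonneg _ _) h4,
      le_mul_of_one_le_left (headIndicator_nonneg _ _) (Real.one_le_rpow h4 zero_le_two)⟩
  have h5 : 1 / 2 ≤ ∑ i, truncAvg 2 fun j => (x k)⁻¹ * (x i * headIndicator k j) := by
    calc _ ≤ _ := half_le_avg_headIndicator k
      _ = ∑ i ∈ Finset.univ.filter (fun i : Fin n => i ≤ k),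
          (1 / (n : ℝ)) * ∑ j, headIndicator k j := by
          rw [Finset.sum_const, card_filter_le, nsmul_eq_mul]
          push_cast
          rfl
      _ ≤ ∑ i ∈ Finset.univ.filter (fun i : Fin n => i ≤ k),
          truncAvg 2 fun j => (x k)⁻¹ * (x i * headIndicator k j) :=
          Finset.sum_le_sum fun i hi => h3 i (Finset.mem_filter.1 hi).2
      _ ≤ _ := Finset.sum_le_sum_of_subset_of_nonneg (Finset.filter_subset _ _)
          fun i _ _ => truncAvg_nonneg (hb i)
  have h6 : ∑ i, truncAvg 2 (fun j => (x k)⁻¹ * (x i * headIndicator k j)) ≤ 1 / 4 := h2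
  linarith

lemma decRearr_of_antitone (hx : ∀ i, 0 ≤ x i) (hanti : Antitone x) : decRearr x = x := by
  have hmono : Monotone fun j => -|x j| := fun i j hij => by
    simp only [abs_of_nonneg (hx _)]
    exact neg_le_neg (hanti hij)
  funext i
  rw [decRearr, Tuple.sort_eq_refl_iff_monotone.2 hmono, Equiv.refl_apply, abs_of_nonneg (hx i)]

lemma decRearr_nonneg (x : Fin n → ℝ) (i : Fin n) : 0 ≤ decRearr x i := abs_nonneg _

lemma decRearr_antitone (x : Fin n → ℝ) : Antitone (decRearr x) := fun _ _ hij =>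
  neg_le_neg_iff.1 (Tuple.monotone_sort (fun j => -|x j|) hij)

lemma decRearr_decRearr (x : Fin n → ℝ) : decRearr (decRearr x) = decRearr x :=
  decRearr_of_antitone (decRearr_nonneg x) (decRearr_antitone x)

lemma hardyHead_nonneg (p : ℝ) (x : Fin n → ℝ) (k : Fin n) : 0 ≤ hardyHead p x k := by
  unfold hardyHead; positivity

lemma hardyTail_nonneg (x : Fin n → ℝ) (k : Fin n) : 0 ≤ hardyTail x k := Real.sqrt_nonneg _

lemma hardyHead_antitone (hp : 0 < p) (x : Fin n → ℝ) : Antitone (hardyHead p x) := by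
  intro k l hkl
  unfold hardyHead
  refine Real.rpow_le_rpow (by positivity) ?_ (by positivity)
  set f : Fin n → ℝ := fun i => |decRearr x i| ^ p with hf
  have hfanti : Antitone f := fun i j hij => by
    simp only [hf, abs_of_nonneg (decRearr_nonneg x _)]
    exact Real.rpow_le_rpow (decRearr_nonneg x _) (decRearr_antitone x hij) hp.le
  have hk0 : (0 : ℝ) < ((k : ℕ) : ℝ) + 1 := by positivity
  have hl0 : (0 : ℝ) < ((l : ℕ) : ℝ) + 1 := by positivity
  have h1 : (((k : ℕ) : ℝ) + 1) * f k ≤ ∑ i with i ≤ k, f i := by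
    have : ∑ i ∈ Finset.univ.filter (fun i : Fin n => i ≤ k), f k = (((k : ℕ) : ℝ) + 1) * f k := by
      rw [Finset.sum_const, card_filter_le, nsmul_eq_mul]
      push_cast
      rfl
    rw [← this]
    exact Finset.sum_le_sum fun i hi => hfanti (Finset.mem_filter.1 hi).2
  have h2 : ∑ i with i ≤ l, f i
      ≤ ∑ i with i ≤ k, f i + (((l : ℕ) : ℝ) - ((k : ℕ) : ℝ)) * f k := by
    have hsub : Finset.univ.filter (fun i : Fin n => i ≤ k)
        ⊆ Finset.univ.filter (fun i : Fin n => i ≤ l) := fun i hi => by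
      simp only [Finset.mem_filter, Finset.mem_univ, true_and] at hi ⊢
      exact hi.trans hkl
    rw [← Finset.sum_sdiff hsub, add_comm]
    refine add_le_add le_rfl ?_
    have hcard : ((Finset.univ.filter (fun i : Fin n => i ≤ l) \
        Finset.univ.filter (fun i : Fin n => i ≤ k)).card : ℝ) = ((l : ℕ) : ℝ) - ((k : ℕ) : ℝ) := by
      rw [Finset.cast_card_sdiff hsub, card_filter_le, card_filter_le]
      push_cast
      ring
    rw [← hcard, ← nsmul_eq_mul]
    refine Finset.sum_le_card_nsmul _ _ _ fun i hi => hfanti ?_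
    simp only [Finset.mem_sdiff, Finset.mem_filter, Finset.mem_univ, true_and, not_le] at hi
    exact hi.2.le
  have hkl' : ((k : ℕ) : ℝ) ≤ ((l : ℕ) : ℝ) := by exact_mod_cast hkl
  rw [one_div_mul_eq_div, one_div_mul_eq_div, div_le_div_iff₀ hl0 hk0]
  nlinarith

lemma hardyTail_antitone (x : Fin n → ℝ) : Antitone (hardyTail x) := by
  intro k l hkl
  unfold hardyTail
  refine Real.sqrt_le_sqrt (mul_le_mul ?_ ?_ (by positivity) (by positivity))
  · have hkl' : ((k : ℕ) : ℝ) ≤ ((l : ℕ) : ℝ) := by exact_mod_cast hkl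
    exact one_div_le_one_div_of_le (by positivity) (by linarith)
  · refine Finset.sum_le_sum_of_subset_of_nonneg (fun i hi => ?_) fun _ _ _ => by positivity
    simp only [Finset.mem_filter, Finset.mem_univ, true_and] at hi ⊢
    exact hkl.trans_lt hi

lemma sum_rpow_le {ι : Type*} (s : Finset ι) {f : ι → ℝ} (hf : ∀ i, 0 ≤ f i) {r : ℝ} (hr : 0 < r)
    (hr1 : r ≤ 1) : (∑ i ∈ s, f i) ^ r ≤ ∑ i ∈ s, f i ^ r := by
  classical
  induction s using Finset.induction_on with
  | empty => simp [Real.zero_rpow hr.ne']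
  | insert i s hi ih =>
    rw [Finset.sum_insert hi, Finset.sum_insert hi]
    exact (Real.rpow_add_le_add_rpow (hf i) (Finset.sum_nonneg fun j _ => hf j) hr.le hr1).trans
      (by linarith)

/-- The origin of the two Hardy vectors. Each coordinate is selected with probability at most `1 /
(k + 1)`. On the indices up to `k`, subadditivity of `t ^ (p/2)` turns squares into `p`-th powers;
on the rest, Jensen's inequality for `t ^ (p/2)` keeps an `ℓ_2`-average. -/
lemma permAvg_ellNorm_headIndicator_rpow_le (hp1 : 1 < p) (hp2 : p < 2) (hx : ∀ i, 0 ≤ x i)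
    (hanti : Antitone x) (k : Fin n) :
    permAvg (fun π => ellNorm 2 (fun i => x i * headIndicator k (π i)) ^ p)
      ≤ (hardyHead p x k + hardyTail x k) ^ p := by
  have hp0 : 0 < p := by linarith
  have hr0 : 0 < p / 2 := by positivity
  have hr1 : p / 2 ≤ 1 := by linarith
  have hw : ∀ (π : Equiv.Perm (Fin n)) i, 0 ≤ x i * headIndicator k (π i) := fun π i =>
    mul_nonneg (hx i) (headIndicator_nonneg _ _)
  have hχ := headIndicator_nonneg k
  have hpath : ∀ π : Equiv.Perm (Fin n),
      ellNorm 2 (fun i => x i * headIndicator k (π i)) ^ p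
        ≤ ∑ i with i ≤ k, x i ^ p * headIndicator k (π i)
          + (∑ i with k < i, x i ^ 2 * headIndicator k (π i)) ^ (p / 2) := by
    intro π
    have e1 : ellNorm 2 (fun i => x i * headIndicator k (π i))
        ^ p = (∑ i, x i ^ 2 * headIndicator k (π i)) ^ (p / 2) := by
      unfold ellNorm
      have e2 : ∀ i, (x i * headIndicator k (π i)) ^ (2 : ℝ) = x i ^ 2 * headIndicator k (π i) :=
        fun i => by
          rw [Real.mul_rpow (hx i) (hχ _), headIndicator_rpow _ _ two_ne_zero, Real.rpow_two]
      simp_rw [e2]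
      rw [← Real.rpow_mul (Finset.sum_nonneg fun i _ => mul_nonneg (sq_nonneg _) (hχ _))]
      congr 1
      ring
    rw [e1, ← Finset.sum_filter_add_sum_filter_not Finset.univ (fun i => i ≤ k)]
    simp only [not_le]
    refine (Real.rpow_add_le_add_rpow
      (Finset.sum_nonneg fun i _ => mul_nonneg (sq_nonneg _) (hχ _))
      (Finset.sum_nonneg fun i _ => mul_nonneg (sq_nonneg _) (hχ _)) hr0.le hr1).trans ?_
    gcongr
    refine (sum_rpow_le _ (fun i => mul_nonneg (sq_nonneg _) (hχ _)) hr0 hr1).trans_eq ?_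
    refine Finset.sum_congr rfl fun i _ => ?_
    rw [Real.mul_rpow (sq_nonneg _) (hχ _), headIndicator_rpow _ _ hr0.ne', ← Real.rpow_two,
      ← Real.rpow_mul (hx i)]
    congr 2
    ring
  have havg : ∀ i : Fin n, permAvg (fun π => headIndicator k (π i)) ≤ 1 / (((k : ℕ) : ℝ) + 1) :=
    fun i => (permAvg_apply i (headIndicator k)).trans_le (avg_headIndicator_le k)
  have hdec := decRearr_of_antitone hx hanti
  have hhead : permAvg (fun π => ∑ i with i ≤ k, x i ^ p * headIndicator k (π i))
      ≤ hardyHead p x k ^ p := by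
    have e : hardyHead p x k ^ p = (1 / (((k : ℕ) : ℝ) + 1)) * ∑ i with i ≤ k, x i ^ p := by
      unfold hardyHead
      rw [← Real.rpow_mul (by positivity), one_div_mul_cancel hp0.ne', Real.rpow_one, hdec]
      simp_rw [abs_of_nonneg (hx _)]
    rw [permAvg_sum, e, Finset.mul_sum]
    refine Finset.sum_le_sum fun i _ => ?_
    rw [permAvg_const_mul, mul_comm]
    exact mul_le_mul_of_nonneg_right (havg i) (Real.rpow_nonneg (hx i) _)
  have htail : permAvg (fun π => (∑ i with k < i, x i ^ 2 * headIndicator k (π i)) ^ (p / 2))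
      ≤ hardyTail x k ^ p := by
    have e : hardyTail x k ^ p
        = ((1 / (((k : ℕ) : ℝ) + 1)) * ∑ i with k < i, x i ^ 2) ^ (p / 2) := by
      unfold hardyTail
      rw [Real.sqrt_eq_rpow, ← Real.rpow_mul (by positivity), hdec]
      simp_rw [sq_abs]
      congr 1
      ring
    have hnn : ∀ π : Equiv.Perm (Fin n), 0 ≤ ∑ i with k < i, x i ^ 2 * headIndicator k (π i) :=
      fun π => Finset.sum_nonneg fun i _ => mul_nonneg (sq_nonneg _) (hχ _)
    refine (permAvg_rpow_le hnn hr0.le hr1).trans ?_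
    rw [e]
    refine Real.rpow_le_rpow (permAvg_nonneg hnn) ?_ hr0.le
    rw [permAvg_sum, Finset.mul_sum]
    refine Finset.sum_le_sum fun i _ => ?_
    rw [permAvg_const_mul, mul_comm]
    exact mul_le_mul_of_nonneg_right (havg i) (sq_nonneg _)
  calc _ ≤ _ := permAvg_mono hpath
    _ ≤ hardyHead p x k ^ p + hardyTail x k ^ p := by
        rw [permAvg_add]
        exact add_le_add hhead htail
    _ ≤ _ := Real.add_rpow_le_rpow_add (hardyHead_nonneg p x k) (hardyTail_nonneg x k) hp1.le

end restriction

/-! ### The Orlicz-Lorentz norm -/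

section norm

variable {n : ℕ} {p A B : ℝ} {a d x : Fin n → ℝ} {M : ℝ → ℝ}

lemma orliczLorentzNorm_le {ρ : ℝ} (hρ : 0 < ρ) (h : ∑ i, M (a i * decRearr x i / ρ) ≤ 1) :
    orliczLorentzNorm M a x ≤ ρ :=
  csInf_le ⟨0, fun _ h => h.1.le⟩ ⟨hρ, h⟩

/-- Makes the infimum defining the norm run over a nonempty set. -/
lemma IsOrliczFunction.exists_sum_map_div_le_one (hM : IsOrliczFunction M) {w : Fin n → ℝ}
    (hw : ∀ i, 0 ≤ w i) : ∃ ρ : ℝ, 0 < ρ ∧ ∑ i, M (w i / ρ) ≤ 1 := by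
  have hS : 0 ≤ ∑ i, M (w i) := Finset.sum_nonneg fun i _ => hM.nonneg (hw i)
  refine ⟨1 + ∑ i, M (w i), by linarith, ?_⟩
  set S := ∑ i, M (w i) with hSdef
  have h1 : ∀ i, M (w i / (1 + S)) ≤ (1 + S)⁻¹ * M (w i) := fun i => by
    rw [div_eq_inv_mul]
    exact hM.map_mul_le (by positivity) (inv_le_one_of_one_le₀ (by linarith)) (hw i)
  calc _ ≤ ∑ i, (1 + S)⁻¹ * M (w i) := Finset.sum_le_sum fun i _ => h1 i
    _ = (1 + S)⁻¹ * S := by rw [← Finset.mul_sum]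
    _ ≤ 1 := by
        rw [inv_mul_le_iff₀ (by linarith)]
        linarith

namespace IsOrliczFunctionOf

variable (h : IsOrliczFunctionOf p A B d M)

include h

lemma permAvg_ellNorm_le_norm (hn : 0 < n) (hp : 1 < p) (hA : 0 < A) (hd : ∀ j, 0 ≤ d j)
    (ha : ∀ i, 0 ≤ a i) (x : Fin n → ℝ) :
    permAvg (fun σ => ellNorm p fun k => a k * decRearr x k * d (σ k))
      ≤ 6 / A * orliczLorentzNorm M a x := by
  have hw : ∀ k, 0 ≤ a k * decRearr x k := fun k => mul_nonneg (ha k) (decRearr_nonneg x k)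
  rw [← div_le_iff₀' (by positivity)]
  refine le_csInf (h.isOrlicz.exists_sum_map_div_le_one hw) fun ρ hρ => ?_
  rw [div_le_iff₀' (by positivity)]
  exact h.permAvg_ellNorm_le hn hp hA hd hw hρ.1 hρ.2

lemma norm_le_permAvg_ellNorm (hn : 0 < n) (hp : 1 < p) (hB : 0 < B) (hd : ∀ j, 0 ≤ d j)
    (hanti : Antitone d) (ha : ∀ i, 0 ≤ a i) (x : Fin n → ℝ) :
    orliczLorentzNorm M a x
      ≤ 96 * B * permAvg (fun σ => ellNorm p fun k => a k * decRearr x k * d (σ k)) := by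
  have hw : ∀ k, 0 ≤ a k * decRearr x k := fun k => mul_nonneg (ha k) (decRearr_nonneg x k)
  refine le_of_forall_gt_imp_ge_of_dense fun ρ hlt => ?_
  have hE : 0 ≤ permAvg (fun σ => ellNorm p fun k => a k * decRearr x k * d (σ k)) :=
    permAvg_nonneg fun σ => ellNorm_nonneg fun k => mul_nonneg (hw k) (hd _)
  have hρ : 0 < ρ := lt_of_le_of_lt (by positivity) hlt
  exact orliczLorentzNorm_le hρ (h.sum_map_div_le_one hn hp hB hd hanti hw hρ hlt)

end IsOrliczFunctionOf

/-! ### Reduction of the triple average to iterated averages of `ℓ_2`-norms -/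

lemma tripleAverage_eq_permAvg (p : ℝ) (a d x : Fin n → ℝ) :
    tripleAverage p a d x = permAvg fun π => permAvg fun σ => permAvg fun η =>
      √(∑ i, ∑ k, |x i * cVec a k (π i) * d (σ k) * zVec n p (η k)| ^ 2) := by
  simp only [tripleAverage, permAvg, ← Finset.mul_sum]
  ring

/-- The sorting permutation is absorbed into `π` by translation, and signs disappear in the squares.
-/
lemma tripleAverage_decRearr (p : ℝ) (a d x : Fin n → ℝ) :
    tripleAverage p a d (decRearr x) = tripleAverage p a d x := by
  set τ := Tuple.sort fun j => -|x j| with hτ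
  rw [tripleAverage_eq_permAvg, tripleAverage_eq_permAvg, eq_comm]
  rw [← permAvg_mul_right (fun π => permAvg fun σ => permAvg fun η =>
    √(∑ i, ∑ k, |decRearr x i * cVec a k (π i) * d (σ k) * zVec n p (η k)| ^ 2)) τ]
  congr 1; funext π; congr 1; funext σ; congr 1; funext η
  congr 1
  refine (Equiv.sum_comp τ _).symm.trans ?_
  refine Finset.sum_congr rfl fun i _ => Finset.sum_congr rfl fun k _ => ?_
  simp only [decRearr, ← hτ, abs_mul, abs_abs, Equiv.Perm.mul_apply]

lemma sqrt_sum_eq_ellNorm (w : Fin n → ℝ) :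
    √(∑ k, w k ^ 2) = ellNorm 2 w := by
  simp [ellNorm, Real.sqrt_eq_rpow]

lemma tripleAverage_eq_permAvg_ellNorm (a d : Fin n → ℝ) (hx : ∀ i, 0 ≤ x i) :
    tripleAverage p a d x = permAvg fun π => permAvg fun σ => permAvg fun η => ellNorm 2 fun k =>
      a k * ellNorm 2 (fun i => x i * headIndicator k (π i)) * d (σ k) * zVec n p (η k) := by
  rw [tripleAverage_eq_permAvg]
  congr 1; funext π; congr 1; funext σ; congr 1; funext η
  have hw : ∀ k i, 0 ≤ x i * headIndicator k (π i) := fun k i =>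
    mul_nonneg (hx i) (headIndicator_nonneg _ _)
  rw [← sqrt_sum_eq_ellNorm, Finset.sum_comm]
  congr 1
  refine Finset.sum_congr rfl fun k _ => ?_
  have e : ellNorm 2 (fun i => x i * headIndicator k (π i)) ^ 2
      = ∑ i, (x i * headIndicator k (π i)) ^ 2 := by
    have := ellNorm_rpow one_le_two (hw k)
    simpa [Real.rpow_two] using this
  simp only [mul_pow, e, Finset.mul_sum, Finset.sum_mul, sq_abs, cVec_eq]
  exact Finset.sum_congr rfl fun i _ => by ring

end norm

/-! ### Two-sided estimates of the triple average -/

section bounds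

variable {n : ℕ} {p A B : ℝ} {a d : Fin n → ℝ} {M : ℝ → ℝ}

/-- The triangle inequality pulls the average over `π` out of the `ℓ_p`-norm, and `z` replaces `ℓ_p`
by `ℓ_2`; `512 = 16 * 32`. -/
lemma permAvg_ellNorm_le_tripleAverage (hn : 0 < n) (hp1 : 1 < p) (ha : ∀ i, 0 ≤ a i)
    (hd : ∀ i, 0 ≤ d i) (x : Fin n → ℝ) :
    permAvg (fun σ => ellNorm p fun k => a k * decRearr x k * d (σ k))
      ≤ 512 * tripleAverage p a d x := by
  have hx := decRearr_nonneg x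
  have hN : ∀ (π : Equiv.Perm (Fin n)) k,
      0 ≤ ellNorm 2 fun i => decRearr x i * headIndicator k (π i) := fun π k =>
    ellNorm_nonneg fun i => mul_nonneg (hx i) (headIndicator_nonneg _ _)
  have hY : ∀ (π σ : Equiv.Perm (Fin n)) k,
      0 ≤ a k * (ellNorm 2 fun i => decRearr x i * headIndicator k (π i)) * d (σ k) :=
    fun π σ k => mul_nonneg (mul_nonneg (ha k) (hN π k)) (hd _)
  rw [← tripleAverage_decRearr, tripleAverage_eq_permAvg_ellNorm a d hx]
  calc _ ≤ permAvg fun σ => 16 * permAvg fun π => ellNorm p fun k =>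
        a k * (ellNorm 2 fun i => decRearr x i * headIndicator k (π i)) * d (σ k) := by
        refine permAvg_mono fun σ => ?_
        calc _ ≤ ellNorm p fun k => 16 * permAvg fun π =>
              a k * (ellNorm 2 fun i => decRearr x i * headIndicator k (π i)) * d (σ k) := by
              refine ellNorm_mono hp1.le
                (fun k => mul_nonneg (mul_nonneg (ha k) (hx k)) (hd _)) fun k => ?_
              rw [permAvg_mul_const, permAvg_const_mul, ← mul_assoc]
              refine mul_le_mul_of_nonneg_right ?_ (hd _)
              rw [mul_left_comm]
              exact mul_le_mul_of_nonneg_left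
                (le_permAvg_ellNorm_headIndicator hx (decRearr_antitone x) k) (ha k)
          _ = 16 * ellNorm p fun k => permAvg fun π =>
              a k * (ellNorm 2 fun i => decRearr x i * headIndicator k (π i)) * d (σ k) :=
              ellNorm_const_mul hp1.le (by norm_num) fun k => permAvg_nonneg fun π => hY π σ k
          _ ≤ _ := mul_le_mul_of_nonneg_left (ellNorm_permAvg_le hp1.le fun π k => hY π σ k)
              (by norm_num)
    _ = 16 * permAvg fun π => permAvg fun σ => ellNorm p fun k =>
        a k * (ellNorm 2 fun i => decRearr x i * headIndicator k (π i)) * d (σ k) := by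
        rw [permAvg_const_mul, permAvg_comm]
    _ ≤ 16 * permAvg fun π => permAvg fun σ => 32 * permAvg fun η => ellNorm 2 fun k =>
        a k * (ellNorm 2 fun i => decRearr x i * headIndicator k (π i)) * d (σ k)
          * zVec n p (η k) := by
        refine mul_le_mul_of_nonneg_left (permAvg_mono fun π => permAvg_mono fun σ => ?_)
          (by norm_num)
        exact ellNorm_le_permAvg_ellNorm_two_zVec hn hp1 (hY π σ)
    _ = _ := by
        simp_rw [permAvg_const_mul]
        ring

/-- For fixed `σ`, concavity of `t ^ (1/p)` moves the average over `π` onto the `p`-th powers, where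
the moment bound applies coordinatewise. -/
lemma tripleAverage_le_permAvg_ellNorm (hn : 0 < n) (hp1 : 1 < p) (hp2 : p < 2)
    (ha : ∀ i, 0 ≤ a i) (hd : ∀ i, 0 ≤ d i) (x : Fin n → ℝ) :
    tripleAverage p a d x ≤ (1 + zConst p) * permAvg fun σ => ellNorm p fun k =>
      a k * (hardyHead p x k + hardyTail x k) * d (σ k) := by
  have hx := decRearr_nonneg x
  have hp0 : 0 < p := by linarith
  have hN : ∀ (π : Equiv.Perm (Fin n)) k,
      0 ≤ ellNorm 2 fun i => decRearr x i * headIndicator k (π i) := fun π k =>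
    ellNorm_nonneg fun i => mul_nonneg (hx i) (headIndicator_nonneg _ _)
  have hY : ∀ (π σ : Equiv.Perm (Fin n)) k,
      0 ≤ a k * (ellNorm 2 fun i => decRearr x i * headIndicator k (π i)) * d (σ k) :=
    fun π σ k => mul_nonneg (mul_nonneg (ha k) (hN π k)) (hd _)
  have hK : 0 ≤ 1 + zConst p := by linarith [zConst_nonneg hp1 hp2]
  rw [← tripleAverage_decRearr, tripleAverage_eq_permAvg_ellNorm a d hx]
  calc _ ≤ permAvg fun π => permAvg fun σ => (1 + zConst p) * ellNorm p fun k =>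
        a k * (ellNorm 2 fun i => decRearr x i * headIndicator k (π i)) * d (σ k) :=
        permAvg_mono fun π => permAvg_mono fun σ =>
          permAvg_ellNorm_two_zVec_le hn hp1 hp2 (hY π σ)
    _ = (1 + zConst p) * permAvg fun σ => permAvg fun π => ellNorm p fun k =>
        a k * (ellNorm 2 fun i => decRearr x i * headIndicator k (π i)) * d (σ k) := by
        simp_rw [permAvg_const_mul]
        rw [permAvg_comm]
    _ ≤ _ := by
        refine mul_le_mul_of_nonneg_left (permAvg_mono fun σ => ?_) hK
        have hYp : ∀ (π : Equiv.Perm (Fin n)) k, 0 ≤ (a k *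
            (ellNorm 2 fun i => decRearr x i * headIndicator k (π i)) * d (σ k)) ^ p :=
          fun π k => Real.rpow_nonneg (hY π σ k) _
        refine (permAvg_rpow_le (fun π => Finset.sum_nonneg fun k _ => hYp π k)
          (by positivity) ((div_le_one hp0).2 hp1.le)).trans ?_
        refine Real.rpow_le_rpow
          (permAvg_nonneg fun π => Finset.sum_nonneg fun k _ => hYp π k) ?_ (by positivity)
        rw [permAvg_sum]
        refine Finset.sum_le_sum fun k _ => ?_
        have had : 0 ≤ a k * d (σ k) := mul_nonneg (ha k) (hd _)
        have hht : 0 ≤ hardyHead p x k + hardyTail x k :=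
          add_nonneg (hardyHead_nonneg p x k) (hardyTail_nonneg x k)
        have e1 : ∀ π : Equiv.Perm (Fin n),
            (a k * (ellNorm 2 fun i => decRearr x i * headIndicator k (π i)) * d (σ k)) ^ p
            = (a k * d (σ k)) ^ p
              * (ellNorm 2 fun i => decRearr x i * headIndicator k (π i)) ^ p := fun π => by
          rw [mul_right_comm, Real.mul_rpow had (hN π k)]
        simp_rw [e1]
        rw [permAvg_const_mul, mul_right_comm, Real.mul_rpow had hht]
        refine mul_le_mul_of_nonneg_left ?_ (Real.rpow_nonneg had _)
        have h := permAvg_ellNorm_headIndicator_rpow_le hp1 hp2 hx (decRearr_antitone x) k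
        simpa only [hardyHead, hardyTail, decRearr_decRearr] using h

/-- Both Hardy vectors are non-increasing, hence equal to their own rearrangements, so each average
is controlled by an Orlicz-Lorentz norm. -/
lemma IsOrliczFunctionOf.permAvg_ellNorm_hardy_le (h : IsOrliczFunctionOf p A B d M) (hn : 0 < n)
    (hp1 : 1 < p) (hA : 0 < A) (hd : ∀ j, 0 ≤ d j) (ha : ∀ i, 0 ≤ a i) (x : Fin n → ℝ) :
    permAvg (fun σ => ellNorm p fun k => a k * (hardyHead p x k + hardyTail x k) * d (σ k))
      ≤ 6 / A * (orliczLorentzNorm M a (hardyHead p x)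
        + orliczLorentzNorm M a (hardyTail x)) := by
  have h1 := h.permAvg_ellNorm_le_norm hn hp1 hA hd ha (hardyHead p x)
  have h2 := h.permAvg_ellNorm_le_norm hn hp1 hA hd ha (hardyTail x)
  rw [decRearr_of_antitone (hardyHead_nonneg p x) (hardyHead_antitone (by linarith) x)] at h1
  rw [decRearr_of_antitone (hardyTail_nonneg x) (hardyTail_antitone x)] at h2
  calc _ ≤ permAvg (fun σ => (ellNorm p fun k => a k * hardyHead p x k * d (σ k))
        + ellNorm p fun k => a k * hardyTail x k * d (σ k)) := by
        refine permAvg_mono fun σ => ?_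
        refine le_trans (le_of_eq ?_) (ellNorm_add_le hp1.le
          (fun k => mul_nonneg (mul_nonneg (ha k) (hardyHead_nonneg p x k)) (hd (σ k)))
          fun k => mul_nonneg (mul_nonneg (ha k) (hardyTail_nonneg x k)) (hd (σ k)))
        congr 1
        funext k
        ring
    _ ≤ _ := by
        rw [permAvg_add]
        linarith

end bounds

end

theorem theorem2 (p : ℝ) (hp1 : 1 < p) (hp2 : p < 2) (A B : ℝ) (hA : 0 < A) (hB : 0 < B) :
    ∃ c₁ : ℝ, 0 < c₁ ∧ ∀ C₁ C₂ : ℝ, 0 < C₁ → 0 < C₂ → ∃ c₂ : ℝ, 0 < c₂ ∧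
      ∀ (n : ℕ) (d a : Fin n → ℝ) (M : ℝ → ℝ),
        Antitone d → (∀ i, 0 < d i) → Antitone a → (∀ i, 0 < a i) →
        IsOrliczFunctionOf p A B d M →
        (∀ x : Fin n → ℝ,
          orliczLorentzNorm M a (hardyHead p x) ≤ C₁ * orliczLorentzNorm M a x) →
        (∀ x : Fin n → ℝ,
          orliczLorentzNorm M a (hardyTail x) ≤ C₂ * orliczLorentzNorm M a x) →
        ∀ x : Fin n → ℝ,
          c₁ * orliczLorentzNorm M a x ≤ tripleAverage p a d x ∧
            tripleAverage p a d x ≤ c₂ * orliczLorentzNorm M a x := by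
  have hK : 0 < 1 + zConst p := by linarith [zConst_nonneg hp1 hp2]
  -- `49152 = 96 * 512` combines the norm equivalence with the lower bound for the triple average.
  refine ⟨1 / (49152 * B), by positivity, fun C₁ C₂ hC₁ hC₂ =>
    ⟨(1 + zConst p) * (6 / A * (C₁ + C₂)), by positivity, ?_⟩⟩
  intro n d a M hdanti hd _ ha hM hhead htail x
  -- For `n = 0` every `ρ > 0` is admissible, so the norm is `inf (0, ∞) = 0`, and the average
  -- vanishes too.
  rcases n.eq_zero_or_pos with rfl | hn
  · have h1 : orliczLorentzNorm M a x = 0 := by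
      have e : {ρ : ℝ | 0 < ρ ∧ ∑ i, M (a i * decRearr x i / ρ) ≤ 1} = Set.Ioi 0 := by
        ext ρ
        simp
      rw [orliczLorentzNorm, e, csInf_Ioi]
    have h2 : tripleAverage p a d x = 0 := by simp [tripleAverage]
    simp [h1, h2]
  have hd0 : ∀ i, 0 ≤ d i := fun i => (hd i).le
  have ha0 : ∀ i, 0 ≤ a i := fun i => (ha i).le
  constructor
  · have h1 := hM.norm_le_permAvg_ellNorm hn hp1 hB hd0 hdanti ha0 x
    have h2 := permAvg_ellNorm_le_tripleAverage (p := p) hn hp1 ha0 hd0 x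
    have h3 := mul_le_mul_of_nonneg_left h2 (by positivity : 0 ≤ 96 * B)
    rw [one_div_mul_eq_div, div_le_iff₀ (by positivity)]
    linarith
  · refine (tripleAverage_le_permAvg_ellNorm hn hp1 hp2 ha0 hd0 x).trans ?_
    rw [mul_assoc]
    refine mul_le_mul_of_nonneg_left ?_ hK.le
    refine (hM.permAvg_ellNorm_hardy_le hn hp1 hA hd0 ha0 x).trans ?_
    rw [mul_assoc]
    refine mul_le_mul_of_nonneg_left ?_ (by positivity)
    linarith [hhead x, htail x]
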